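/- Let $\Omega\subset\mathbb{R}^n$ be open, connected and $\mathbb{Z}^n$-periodic ($\Omega+\mathbb{Z}^n=\Omega$) with nonempty $C^1$ boundary, and put $\Omega_\varepsilon=\varepsilon\Omega$ for $\varepsilon>0$. Let $H:\mathbb{R}^n\times\mathbb{R}^n\to\mathbb{R}$, $b:\mathbb{R}^n\times\partial\Omega\to\mathbb{R}$, $g:\mathbb{R}^n\to\mathbb{R}$, put $\overline b(x)=\min_{z\in\partial\Omega}b(x,z)$, and assume: - $(\mathcal A_1)$ $H$ is continuous, and $y\mapsto H(y,p)$ is $\mathbb{Z}^n$-periodic for every $p$; - $(\mathcal A_2)$ $\lim_{|p|\to\infty}\inf_{y}H(y,p)=+\infty$; - $(\mathcal A_3)$ $p\mapsto H(y,p)$ is convex for every $y$; - $(\mathcal A_4)$ $b$ is bounded and uniformly continuous, and $y\mapsto b(x,y)$ is $\mathbb{Z}^n$-periodic for every $x$; - $(\mathcal A_5)$ $g$ is bounded and Lipschitz continuous, and $g\le\overline b$ on $\mathbb{R}^n$; - $(\mathcal A_7)$ $\min_{p}H(y,p)=H(y,0)=0$ for every $y$. For $p\in\mathbb{R}^n$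 let $\overline H(p)$ be the effective Hamiltonian, i.e. the unique constant $c$ for which there is a continuous $\mathbb{Z}^n$-periodic viscosity solution $v$ of $H(y,p+Dv)\le c$ in $\Omega$, $H(y,p+Dv)\ge c$ on $\overline\Omega$. Solutions of the evolution problems below are understood in the viscosity sense, continuous up to the boundary and up to $t=0$, and bounded on $[0,T]$ (uniformly in space) for every $T>0$. (a) Let $\varepsilon>0$ and let $u^\varepsilon$ be the viscosity solution of $$u^\varepsilon_t+H\left(\tfrac{x}{\varepsilon},Du^\varepsilon\right)=0\ \text{ in }\Omega_\varepsilon\times(0,\infty),\qquad u^\varepsilon=b\left(x,\tfrac{x}{\varepsilon}\right)\ \text{ on }\partial\Omega_\varepsilon\times(0,\infty),\qquad u^\varepsilon(\cdot,0)=g\ \text{ on }\overline\Omega_\varepsilon,$$ where the boundary condition is taken in the generalized sense, i.e. $\min\{u^\varepsilon_t+H,\,u^\varepsilon-b\}\le 0\le\max\{u^\varepsilon_t+H,\,u^\varepsilon-b\}$ on $\partial\Omega_\varepsilon\times(0,\infty)$ in the viscosity sense. Then $u^\varepsilon=\hat u^\varepsilon$ on $\overline\Omega_\varepsilon\times[0,\infty)$,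 where $\hat u^\varepsilon$ is the unique solution of the state-constraint problem $$\hat u^\varepsilon_t+H\left(\tfrac{x}{\varepsilon},D\hat u^\varepsilon\right)\le 0\ \text{ in }\Omega_\varepsilon\times(0,\infty),\qquad \hat u^\varepsilon_t+H\left(\tfrac{x}{\varepsilon},D\hat u^\varepsilon\right)\ge 0\ \text{ on }\overline\Omega_\varepsilon\times(0,\infty),\qquad \hat u^\varepsilon(\cdot,0)=g\ \text{ on }\overline\Omega_\varepsilon.$$ (b) Let $u$ be the viscosity solution of $$\max\{u-\overline b,\;u_t+\overline H(Du)\}=0\ \text{ in }\mathbb{R}^n\times(0,\infty),\qquad u(\cdot,0)=g\ \text{ on }\mathbb{R}^n.$$ Then $u=\hat u$ on $\mathbb{R}^n\times[0,\infty)$, where $\hat u$ is the unique solution of $$\hat u_t+\overline H(D\hat u)=0\ \text{ in }\mathbb{R}^n\times(0,\infty),\qquad \hat u(\cdot,0)=g\ \text{ on }\mathbb{R}^n.$$ -/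

import Mathlib

open Set Filter Topology
open scoped Pointwise

namespace PerforatedHJ

/-- `ℝⁿ` with its Euclidean structure. -/
abbrev Euc (n : ℕ) : Type := EuclideanSpace ℝ (Fin n)

/-- The vector of `ℝⁿ` with integer coordinates `k`. -/
def latticeVec {n : ℕ} (k : Fin n → ℤ) : Euc n := WithLp.toLp 2 fun i => (k i : ℝ)

/-- `Ω` has a `C¹` boundary: near each boundary point, `Ω` is the part of a ball lying strictly
above the graph of a `C¹` function over the hyperplane orthogonal to some unit vector `ν`
(`x - ⟪ν, x⟫ ν` is the projection of `x` to that hyperplane). -/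
def HasC1Boundary {n : ℕ} (Ω : Set (Euc n)) : Prop :=
  ∀ x₀ ∈ frontier Ω, ∃ (ν : Euc n) (γ : Euc n → ℝ) (r : ℝ),
    ‖ν‖ = 1 ∧ ContDiff ℝ 1 γ ∧ 0 < r ∧
      ∀ x ∈ Metric.ball x₀ r, (x ∈ Ω ↔ γ (x - inner ℝ ν x • ν) < inner ℝ ν x)

/-- A perforated domain: open, connected (in particular nonempty), `ℤⁿ`-periodic, with nonempty
`C¹` boundary. -/
structure IsPerforatedDomain {n : ℕ} (Ω : Set (Euc n)) : Prop where
  isOpen : IsOpen Ω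
  isConnected : IsConnected Ω
  periodic : ∀ (k : Fin n → ℤ) (y : Euc n), y + latticeVec k ∈ Ω ↔ y ∈ Ω
  c1Boundary : HasC1Boundary Ω
  frontier_nonempty : (frontier Ω).Nonempty

/-- `b̄(x) = min_{z ∈ ∂Ω} b(x, z)`. -/
noncomputable def bBar {n : ℕ} (Ω : Set (Euc n)) (b : Euc n → Euc n → ℝ) (x : Euc n) : ℝ :=
  sInf (b x '' frontier Ω)

/-! ### Assumptions on the data -/

/-- `H` is continuous and `ℤⁿ`-periodic in its first variable. -/
def A1 {n : ℕ} (H : Euc n → Euc n → ℝ) : Prop :=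
  Continuous (fun q : Euc n × Euc n => H q.1 q.2) ∧
    ∀ (p y : Euc n) (k : Fin n → ℤ), H (y + latticeVec k) p = H y p

/-- `inf_y H(y, p) → +∞` as `|p| → ∞`. -/
def A2 {n : ℕ} (H : Euc n → Euc n → ℝ) : Prop :=
  Tendsto (fun p => ⨅ y, H y p) (Bornology.cobounded (Euc n)) atTop

/-- `H` is convex in `p`. -/
def A3 {n : ℕ} (H : Euc n → Euc n → ℝ) : Prop :=
  ∀ y, ConvexOn ℝ univ (H y)

/-- `b` is bounded and uniformly continuous on `ℝⁿ × ∂Ω`, and `ℤⁿ`-periodic in its second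
variable. -/
def A4 {n : ℕ} (Ω : Set (Euc n)) (b : Euc n → Euc n → ℝ) : Prop :=
  (∃ C, ∀ x, ∀ y ∈ frontier Ω, |b x y| ≤ C) ∧
    UniformContinuousOn (fun q : Euc n × Euc n => b q.1 q.2) (univ ×ˢ frontier Ω) ∧
    ∀ x, ∀ y ∈ frontier Ω, ∀ k : Fin n → ℤ, b x (y + latticeVec k) = b x y

/-- `g` is bounded and Lipschitz (hence uniformly) continuous on `ℝⁿ`, and `g ≤ b̄`. -/
def A5 {n : ℕ} (Ω : Set (Euc n)) (b : Euc n → Euc n → ℝ) (g : Euc n → ℝ) : Prop :=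
  (∃ C, ∀ x, |g x| ≤ C) ∧ (∃ K, LipschitzWith K g) ∧ ∀ x, g x ≤ bBar Ω b x

/-- `min_p H(y, p) = H(y, 0) = 0` for every `y`. -/
def A7 {n : ℕ} (H : Euc n → Euc n → ℝ) : Prop :=
  ∀ y, H y 0 = 0 ∧ ∀ p, 0 ≤ H y p

/-! ### Viscosity solutions of evolution equations

An equation is given by `F : (x, t) ↦ r ↦ a ↦ p ↦ F(x, t, r, a, p)`, where `r`, `a`, `p` stand
for `u`, `u_t`, `Du`. -/

/-- `F(x, t, u, u_t, Du) ≤ 0` on `A` in the viscosity sense, where `u` is tested on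
`S ⊇ A`. -/
def ViscSub {n : ℕ} (S A : Set (Euc n × ℝ)) (F : Euc n × ℝ → ℝ → ℝ → Euc n → ℝ)
    (u : Euc n × ℝ → ℝ) : Prop :=
  ∀ z ∈ A, ∀ φ : Euc n × ℝ → ℝ, ContDiff ℝ 1 φ → IsLocalMaxOn (fun w => u w - φ w) S z →
    F z (u z) (deriv (fun s => φ (z.1, s)) z.2) (gradient (fun x => φ (x, z.2)) z.1) ≤ 0

/-- `F(x, t, u, u_t, Du) ≥ 0` on `A` in the viscosity sense, where `u` is tested on
`S ⊇ A`. -/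
def ViscSuper {n : ℕ} (S A : Set (Euc n × ℝ)) (F : Euc n × ℝ → ℝ → ℝ → Euc n → ℝ)
    (u : Euc n × ℝ → ℝ) : Prop :=
  ∀ z ∈ A, ∀ φ : Euc n × ℝ → ℝ, ContDiff ℝ 1 φ → IsLocalMinOn (fun w => u w - φ w) S z →
    0 ≤ F z (u z) (deriv (fun s => φ (z.1, s)) z.2) (gradient (fun x => φ (x, z.2)) z.1)

/-- The class in which solutions are sought: continuous on `K × [0, ∞)`, bounded on
`K × [0, T]` for every `T`, with initial value `g` on `K`. -/
structure InClass {n : ℕ} (K : Set (Euc n)) (g : Euc n → ℝ) (u : Euc n × ℝ → ℝ) : Prop where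
  cont : ContinuousOn u (K ×ˢ Ici 0)
  bdd : ∀ T : ℝ, ∃ C, ∀ x ∈ K, ∀ t ∈ Icc 0 T, |u (x, t)| ≤ C
  init : ∀ x ∈ K, u (x, 0) = g x

/-- The operator `u_t + H(x/ε, Du)`. -/
noncomputable def opEps {n : ℕ} (H : Euc n → Euc n → ℝ) (ε : ℝ) :
    Euc n × ℝ → ℝ → ℝ → Euc n → ℝ :=
  fun z _ a p => a + H (ε⁻¹ • z.1) p

/-- `u` solves `u_t + H(x/ε, Du) = 0` in `Ω_ε × (0, ∞)`, `u = b(x, x/ε)` on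
`∂Ω_ε × (0, ∞)` and `u(·, 0) = g` on the closure of `Ω_ε = εΩ`, with the boundary condition in the
generalized viscosity sense: on the boundary, `min (u_t + H, u - b) ≤ 0 ≤ max (u_t + H, u - b)`. -/
structure IsDirichletSolution {n : ℕ} (H : Euc n → Euc n → ℝ) (Ω : Set (Euc n))
    (b : Euc n → Euc n → ℝ) (g : Euc n → ℝ) (ε : ℝ) (u : Euc n × ℝ → ℝ) : Prop where
  inClass : InClass (closure (ε • Ω)) g u
  sub_interior : ViscSub ((ε • Ω) ×ˢ Ioi 0) ((ε • Ω) ×ˢ Ioi 0) (opEps H ε) u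
  super_interior : ViscSuper ((ε • Ω) ×ˢ Ioi 0) ((ε • Ω) ×ˢ Ioi 0) (opEps H ε) u
  sub_boundary : ViscSub (closure (ε • Ω) ×ˢ Ioi 0) (frontier (ε • Ω) ×ˢ Ioi 0)
    (fun z r a p => min (opEps H ε z r a p) (r - b z.1 (ε⁻¹ • z.1))) u
  super_boundary : ViscSuper (closure (ε • Ω) ×ˢ Ioi 0) (frontier (ε • Ω) ×ˢ Ioi 0)
    (fun z r a p => max (opEps H ε z r a p) (r - b z.1 (ε⁻¹ • z.1))) u

/-- `u` solves the state-constraint problem: `u_t + H(x/ε, Du) ≤ 0` in `Ω_ε × (0, ∞)`,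
`u_t + H(x/ε, Du) ≥ 0` on `closure Ω_ε × (0, ∞)`, `u(·, 0) = g` on `closure Ω_ε`. -/
structure IsStateConstraintSolution {n : ℕ} (H : Euc n → Euc n → ℝ) (Ω : Set (Euc n))
    (g : Euc n → ℝ) (ε : ℝ) (u : Euc n × ℝ → ℝ) : Prop where
  inClass : InClass (closure (ε • Ω)) g u
  sub : ViscSub ((ε • Ω) ×ˢ Ioi 0) ((ε • Ω) ×ˢ Ioi 0) (opEps H ε) u
  super : ViscSuper (closure (ε • Ω) ×ˢ Ioi 0) (closure (ε • Ω) ×ˢ Ioi 0) (opEps H ε) u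

/-! ### The effective Hamiltonian -/

/-- `v` is a `ℤⁿ`-periodic continuous viscosity solution of the state-constraint cell problem
`H(y, p + Dv) ≤ c` in `Ω`, `H(y, p + Dv) ≥ c` on `closure Ω`. -/
structure IsCellSolution {n : ℕ} (H : Euc n → Euc n → ℝ) (Ω : Set (Euc n)) (p : Euc n) (c : ℝ)
    (v : Euc n → ℝ) : Prop where
  cont : ContinuousOn v (closure Ω)
  periodic : ∀ y ∈ closure Ω, ∀ k : Fin n → ℤ, v (y + latticeVec k) = v y
  sub : ∀ y ∈ Ω, ∀ ψ : Euc n → ℝ, ContDiff ℝ 1 ψ → IsLocalMaxOn (fun x => v x - ψ x) Ω y →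
    H y (p + gradient ψ y) ≤ c
  super : ∀ y ∈ closure Ω, ∀ ψ : Euc n → ℝ, ContDiff ℝ 1 ψ →
    IsLocalMinOn (fun x => v x - ψ x) (closure Ω) y → c ≤ H y (p + gradient ψ y)

/-- `Hbar p` is, for every `p`, a constant for which the cell problem is solvable. -/
def IsEffectiveHamiltonian {n : ℕ} (H : Euc n → Euc n → ℝ) (Ω : Set (Euc n))
    (Hbar : Euc n → ℝ) : Prop :=
  ∀ p, ∃ v, IsCellSolution H Ω p (Hbar p) v

open Classical in
/-- The effective Hamiltonian `H̄ = H̄_Ω`: the function whose value at each `p` is the constant for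
which the cell problem is solvable. (For continuous, periodic, coercive `H` on a perforated domain
there is exactly one such function; the value `0` is only a default when there is none.) -/
noncomputable def effectiveHamiltonian {n : ℕ} (H : Euc n → Euc n → ℝ) (Ω : Set (Euc n)) :
    Euc n → ℝ :=
  if h : ∃ Hbar, IsEffectiveHamiltonian H Ω Hbar then h.choose else 0

/-! ### Limit problems on `ℝⁿ` -/

/-- `u` solves `max (u - β(x), u_t + G(Du)) = 0` in `ℝⁿ × (0, ∞)`, `u(·, 0) = g`. -/
structure IsObstacleSolution {n : ℕ} (G : Euc n → ℝ) (β g : Euc n → ℝ) (u : Euc n × ℝ → ℝ) :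
    Prop where
  inClass : InClass univ g u
  sub : ViscSub (univ ×ˢ Ioi 0) (univ ×ˢ Ioi 0) (fun z r a p => max (r - β z.1) (a + G p)) u
  super : ViscSuper (univ ×ˢ Ioi 0) (univ ×ˢ Ioi 0) (fun z r a p => max (r - β z.1) (a + G p)) u

/-- `u` solves `u_t + G(Du) = 0` in `ℝⁿ × (0, ∞)`, `u(·, 0) = g`. -/
structure IsCauchySolution {n : ℕ} (G : Euc n → ℝ) (g : Euc n → ℝ) (u : Euc n × ℝ → ℝ) :
    Prop where
  inClass : InClass univ g u
  sub : ViscSub (univ ×ˢ Ioi 0) (univ ×ˢ Ioi 0) (fun _ _ a p => a + G p) u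
  super : ViscSuper (univ ×ˢ Ioi 0) (univ ×ˢ Ioi 0) (fun _ _ a p => a + G p) u

end PerforatedHJ

open PerforatedHJ

/-! Everything rests on monotonicity in time. Since `H ≥ 0`, and hence the effective Hamiltonian is
nonnegative too, subsolutions are nonincreasing in time (`antitone_of_viscSub`), so they stay below
`g` and therefore below `b` or `b̄`. Where the boundary value or the obstacle is the active
alternative in the supersolution condition, `u` is at least the obstacle, hence at least all its
past values at that point. A smooth function touching `u` from below there has nonnegative time
derivative, and the inequality `u_t + H ≥ 0` holds anyway. Thus a Dirichlet solution is a
state-constraint solution and an obstacle solution is a Cauchy solution.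

The identification with the other solution is a comparison principle (`comparison`), for
supersolutions that hold up to the boundary. The doubling penalty is shifted along an inward
direction, as in Soner's method, which pushes the subsolution's point into the open domain
(`exists_isMaxOn_penalized`, `HasInwardCone`). Strictness comes from mixing the subsolution with a
smooth strict one, which convexity of the Hamiltonian permits (`no_strict_max`). Coercivity controls
the dependence on `x` only on sublevel sets of `H`, so the subsolution is first replaced by
`lipEnvelope`, whose rate of decrease in time is bounded; the equation then bounds the Hamiltonian
along it. Lipschitz initial data make this envelope a subsolution.

For the limit problem, nonnegativity, local boundedness and convexity of the effective Hamiltonian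
are read off the cell problem, the last by the same shifted doubling. -/

namespace PerforatedHJ

/-! ### Doubling of variables with a shifted penalty -/

/-- Doubling of variables with a shifted penalization: the maximum points of
`f x - h y - N ((x - ι y) / δ - ν)` concentrate at a strict maximum point `y₀` of `f ∘ ι - h`, and
`x` is close to `ι y + δ ν` to order `o(δ)`. -/
lemma exists_isMaxOn_penalized {E₁ E₂ : Type*} [NormedAddCommGroup E₁] [NormedSpace ℝ E₁]
    [NormedAddCommGroup E₂] {K₁ : Set E₁} {K₂ : Set E₂}
    (hK₁ : IsCompact K₁) (hK₂ : IsCompact K₂) {f : E₁ → ℝ} {h : E₂ → ℝ} {ι : E₂ → E₁} {N : E₁ → ℝ}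
    (hf : ContinuousOn f K₁) (hh : ContinuousOn h K₂) (hι : Continuous ι) (hN : Continuous N)
    (hN0 : N 0 = 0) (hNge : ∀ w, ‖w‖ ^ 2 ≤ N w) {y₀ : E₂} (hy₀ : y₀ ∈ K₂) (hιy₀ : ι y₀ ∈ K₁)
    (hstrict : ∀ y ∈ K₂, ι y ∈ K₁ → f (ι y₀) - h y₀ ≤ f (ι y) - h y → y = y₀) {ν : E₁}
    (hν : ∀ᶠ δ in 𝓝[>] (0 : ℝ), ι y₀ + δ • ν ∈ K₁) {ρ : ℝ} (hρ : 0 < ρ) :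
    ∃ δ, 0 < δ ∧ δ < ρ ∧ ∃ x ∈ K₁, ∃ y ∈ K₂, dist y y₀ < ρ ∧ dist x (ι y₀) < ρ ∧
      ‖x - ι y - δ • ν‖ < ρ * δ ∧
      ∀ x' ∈ K₁, ∀ y' ∈ K₂, f x' - h y' - N (δ⁻¹ • (x' - ι y') - ν) ≤
        f x - h y - N (δ⁻¹ • (x - ι y) - ν) := by
  have hmax : ∀ δ : ℝ, ∃ q ∈ K₁ ×ˢ K₂, IsMaxOn
      (fun q : E₁ × E₂ => f q.1 - h q.2 - N (δ⁻¹ • (q.1 - ι q.2) - ν)) (K₁ ×ˢ K₂) q := by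
    intro δ
    refine (hK₁.prod hK₂).exists_isMaxOn ⟨(ι y₀, y₀), hιy₀, hy₀⟩ ?_
    refine ((hf.comp continuousOn_fst fun q hq => hq.1).sub
      (hh.comp continuousOn_snd fun q hq => hq.2)).sub (Continuous.continuousOn ?_)
    fun_prop
  choose q hqK hqmax using hmax
  obtain ⟨δ, hδlim⟩ : ∃ δ : ℕ → ℝ, Tendsto δ atTop (𝓝[>] 0) :=
    ⟨fun k => 1 / ((k : ℝ) + 1), tendsto_nhdsWithin_iff.2
      ⟨tendsto_one_div_add_atTop_nhds_zero_nat, Eventually.of_forall fun k => by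
        simp only [mem_Ioi]; positivity⟩⟩
  obtain ⟨⟨xs, ys⟩, ⟨hxs, hys⟩, σ, hσ, hlim⟩ :=
    (hK₁.prod hK₂).tendsto_subseq (x := fun k => q (δ k)) fun k => hqK _
  set d : ℕ → ℝ := fun k => δ (σ k) with hd
  have hd0 : Tendsto d atTop (𝓝[>] 0) := hδlim.comp hσ.tendsto_atTop
  have hd0' : Tendsto d atTop (𝓝 0) := hd0.mono_right nhdsWithin_le_nhds
  have hdpos : ∀ᶠ k in atTop, 0 < d k := hd0.eventually self_mem_nhdsWithin
  set x : ℕ → E₁ := fun k => (q (d k)).1 with hx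
  set y : ℕ → E₂ := fun k => (q (d k)).2 with hy
  have hxK : ∀ k, x k ∈ K₁ := fun k => (hqK _).1
  have hyK : ∀ k, y k ∈ K₂ := fun k => (hqK _).2
  have hxlim : Tendsto x atTop (𝓝 xs) := (continuous_fst.tendsto _).comp hlim
  have hylim : Tendsto y atTop (𝓝 ys) := (continuous_snd.tendsto _).comp hlim
  have hfx : Tendsto (fun k => f (x k)) atTop (𝓝 (f xs)) :=
    (hf xs hxs).tendsto.comp (tendsto_nhdsWithin_iff.2 ⟨hxlim, Eventually.of_forall hxK⟩)
  have hhy : Tendsto (fun k => h (y k)) atTop (𝓝 (h ys)) :=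
    (hh ys hys).tendsto.comp (tendsto_nhdsWithin_iff.2 ⟨hylim, Eventually.of_forall hyK⟩)
  have hshiftK : ∀ᶠ k in atTop, ι y₀ + d k • ν ∈ K₁ := hd0.eventually hν
  have hshift : Tendsto (fun k => ι y₀ + d k • ν) atTop (𝓝 (ι y₀)) := by
    simpa using (tendsto_const_nhds (x := ι y₀)).add (hd0'.smul_const ν)
  have hfs : Tendsto (fun k => f (ι y₀ + d k • ν)) atTop (𝓝 (f (ι y₀))) :=
    (hf _ hιy₀).tendsto.comp (tendsto_nhdsWithin_iff.2 ⟨hshift, hshiftK⟩)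
  set w : ℕ → E₁ := fun k => (d k)⁻¹ • (x k - ι (y k)) - ν with hw
  set r : ℕ → ℝ := fun k => f (x k) - h (y k) - f (ι y₀ + d k • ν) + h y₀ with hr
  have hrlim : Tendsto r atTop (𝓝 (f xs - h ys - f (ι y₀) + h y₀)) :=
    ((hfx.sub hhy).sub hfs).add_const _
  -- At the competitor `(ι y₀ + δ ν, y₀)` the penalty vanishes, so maximality bounds the penalty at
  -- the maximum point by `r`.
  have hNr : ∀ᶠ k in atTop, N (w k) ≤ r k := by
    filter_upwards [hdpos, hshiftK] with k hk hsk
    have h1 := hqmax (d k) (show (ι y₀ + d k • ν, y₀) ∈ K₁ ×ˢ K₂ from ⟨hsk, hy₀⟩)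
    simp only [mem_ofPred_eq, add_sub_cancel_left, smul_smul, inv_mul_cancel₀ hk.ne', one_smul,
      sub_self, hN0] at h1
    simp only [hr, hw, hx, hy]
    linarith
  have hwr : ∀ᶠ k in atTop, ‖w k‖ ^ 2 ≤ r k := hNr.mono fun k hk => (hNge _).trans hk
  have hdw : ∀ᶠ k in atTop, x k - ι (y k) = d k • (w k + ν) := by
    filter_upwards [hdpos] with k hk
    simp [hw, smul_smul, mul_inv_cancel₀ hk.ne']
  have hdwlim : Tendsto (fun k => d k • (w k + ν)) atTop (𝓝 0) := by
    have hb : ∀ᶠ k in atTop, ‖w k + ν‖ ≤ (f xs - h ys - f (ι y₀) + h y₀ + 2) + ‖ν‖ := by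
      filter_upwards [hwr, hrlim.eventually_lt_const (lt_add_one _)] with k h1 h2
      have := norm_add_le (w k) ν
      nlinarith [sq_nonneg (‖w k‖ - 1)]
    exact NormedField.tendsto_zero_smul_of_tendsto_zero_of_bounded hd0' ⟨_, hb⟩
  have hxs_eq : xs = ι ys := by
    have h1 : Tendsto (fun k => x k - ι (y k)) atTop (𝓝 (xs - ι ys)) :=
      hxlim.sub ((hι.tendsto _).comp hylim)
    exact sub_eq_zero.1 (tendsto_nhds_unique h1 (hdwlim.congr' (hdw.mono fun k hk => hk.symm)))
  subst hxs_eq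
  have hr0 : 0 ≤ f (ι ys) - h ys - f (ι y₀) + h y₀ :=
    ge_of_tendsto hrlim (hwr.mono fun k hk => (sq_nonneg _).trans hk)
  -- Passing to the limit in `0 ≤ r` makes the limit point a maximum point, so strictness identifies
  -- it. Then `r → 0`, which forces `w → 0`; this is the `o(δ)` estimate.
  obtain rfl : ys = y₀ := hstrict ys hys hxs (by linarith)
  have hr0 : Tendsto r atTop (𝓝 0) := by convert hrlim using 2; ring
  have hwlt : ∀ᶠ k in atTop, ‖w k‖ < ρ := by
    filter_upwards [hwr, hr0.eventually_lt_const (pow_pos hρ 2)] with k h1 h2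
    exact lt_of_pow_lt_pow_left₀ 2 hρ.le (h1.trans_lt h2)
  obtain ⟨k, h1, h2, h3, h4, h5, h6⟩ := (hdpos.and <| (hd0'.eventually_lt_const hρ).and <|
    hwlt.and <| hdw.and <| (hxlim.eventually (Metric.ball_mem_nhds _ hρ)).and
    (hylim.eventually (Metric.ball_mem_nhds _ hρ))).exists
  refine ⟨d k, h1, h2, x k, hxK k, y k, hyK k, h6, h5, ?_, fun x' hx' y' hy' =>
    hqmax (d k) (show (x', y') ∈ K₁ ×ˢ K₂ from ⟨hx', hy'⟩)⟩
  rw [h4, ← smul_sub, add_sub_cancel_right, norm_smul, Real.norm_of_nonneg h1.le, mul_comm]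
  exact mul_lt_mul_of_pos_right h3 h1

/-! ### Gradients of penalties and one-sided derivative tests -/

section Calculus

variable {n : ℕ}

lemma hasGradientAt_penalty (c : ℝ) (y ν x : Euc n) :
    HasGradientAt (fun x => ‖c • (x - y) - ν‖ ^ 2) ((2 * c) • (c • (x - y) - ν)) x := by
  rw [hasGradientAt_iff_hasFDerivAt]
  have h : HasFDerivAt (fun x : Euc n => c • (x - y) - ν) (c • ContinuousLinearMap.id ℝ (Euc n)) x :=
    (((hasFDerivAt_id x).sub_const y).const_smul c).sub_const ν
  refine h.norm_sq.congr_fderiv ?_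
  ext v
  simp
  ring

lemma hasGradientAt_penalty_right (c : ℝ) (x ν y : Euc n) :
    HasGradientAt (fun y => -‖c • (x - y) - ν‖ ^ 2) ((2 * c) • (c • (x - y) - ν)) y := by
  rw [hasGradientAt_iff_hasFDerivAt]
  have h : HasFDerivAt (fun y : Euc n => c • (x - y) - ν) (c • -ContinuousLinearMap.id ℝ (Euc n)) y :=
    (((hasFDerivAt_id y).const_sub x).const_smul c).sub_const ν
  refine h.norm_sq.neg.congr_fderiv ?_
  ext v
  simp
  ring

/-- The smooth function `√(1 + |x|²)`. -/
noncomputable def smoothNorm (x : Euc n) : ℝ := √(1 + ‖x‖ ^ 2)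

lemma contDiff_smoothNorm : ContDiff ℝ 1 (smoothNorm (n := n)) :=
  ContDiff.sqrt (contDiff_const.add (contDiff_id.norm_sq ℝ)) fun x => by positivity

lemma one_le_smoothNorm (x : Euc n) : 1 ≤ smoothNorm x :=
  Real.one_le_sqrt.2 (by nlinarith [sq_nonneg ‖x‖])

lemma norm_le_smoothNorm (x : Euc n) : ‖x‖ ≤ smoothNorm x :=
  Real.le_sqrt_of_sq_le (by linarith)

lemma eq_zero_of_smoothNorm_le_one {x : Euc n} (h : smoothNorm x ≤ 1) : x = 0 := by
  rw [smoothNorm, Real.sqrt_le_one] at h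
  have : ‖x‖ ^ 2 ≤ 0 := by linarith
  simpa using le_antisymm this (sq_nonneg _)

/-- As a penalty at infinity or around a point, `smoothNorm` costs only a bounded gradient, and the
Hamiltonian is bounded for bounded gradients. -/
lemma exists_hasGradientAt_smoothNorm (a x : Euc n) :
    ∃ p : Euc n, ‖p‖ ≤ 1 ∧ HasGradientAt (fun x => smoothNorm (x - a)) p x := by
  have hpos : 0 < smoothNorm (x - a) := one_pos.trans_le (one_le_smoothNorm _)
  refine ⟨(smoothNorm (x - a))⁻¹ • (x - a), ?_, ?_⟩
  · rw [norm_smul, norm_inv, Real.norm_of_nonneg hpos.le, inv_mul_le_one₀ hpos]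
    exact norm_le_smoothNorm _
  · rw [hasGradientAt_iff_hasFDerivAt]
    have h1 : HasFDerivAt (fun x : Euc n => 1 + ‖x - a‖ ^ 2) _ x :=
      (((hasFDerivAt_id x).sub_const a).norm_sq).const_add 1
    refine (h1.sqrt (by positivity)).congr_fderiv ?_
    ext v
    simp [smoothNorm]
    ring

lemma deriv_nonneg_of_eventually_right {f : ℝ → ℝ} {f' a : ℝ} (hf : HasDerivAt f f' a)
    (h : ∀ᶠ t in 𝓝[>] a, f a ≤ f t) : 0 ≤ f' := by
  refine ge_of_tendsto (hf.tendsto_slope.mono_left (nhdsGT_le_nhdsNE a)) ?_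
  filter_upwards [h, self_mem_nhdsWithin] with t ht hta
  rw [slope_def_field]
  exact div_nonneg (sub_nonneg.2 ht) (sub_nonneg.2 (le_of_lt hta))

lemma deriv_nonneg_of_eventually_left {f : ℝ → ℝ} {f' a : ℝ} (hf : HasDerivAt f f' a)
    (h : ∀ᶠ t in 𝓝[<] a, f t ≤ f a) : 0 ≤ f' := by
  refine ge_of_tendsto (hf.tendsto_slope.mono_left (nhdsLT_le_nhdsNE a)) ?_
  filter_upwards [h, self_mem_nhdsWithin] with t ht hta
  rw [slope_def_field]
  exact div_nonneg_of_nonpos (sub_nonpos.2 ht) (sub_nonpos.2 (le_of_lt hta))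

/-- A lower bound on the increments of a function bounds its gradient. -/
lemma norm_gradient_le_of_increment_ge {f : Euc n → ℝ} {p x : Euc n} {L : ℝ} (hL : 0 ≤ L)
    (hf : HasGradientAt f p x) (h : ∀ᶠ y in 𝓝 x, f x - L * ‖y - x‖ ≤ f y) : ‖p‖ ≤ L := by
  rcases eq_or_ne p 0 with rfl | hp
  · simpa
  -- Along the steepest descent direction `-p` the function has slope `-‖p‖ ^ 2`, while the
  -- increment bound allows no less than `-L * ‖p‖`.
  have hline : HasDerivAt (fun t : ℝ => x - t • p) (-p) 0 := by
    simpa using ((hasDerivAt_id (0 : ℝ)).smul_const p).const_sub x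
  have hx : x - (0 : ℝ) • p = x := by simp
  have hfx : HasFDerivAt f (InnerProductSpace.toDual ℝ (Euc n) p) (x - (0 : ℝ) • p) := by
    rw [hx]; exact hf.hasFDerivAt
  have hder : HasDerivAt (fun t : ℝ => f (x - t • p) + L * ‖p‖ * t) (-‖p‖ ^ 2 + L * ‖p‖) 0 := by
    refine ((hfx.comp_hasDerivAt (0 : ℝ) hline).add
      ((hasDerivAt_id (0 : ℝ)).const_mul (L * ‖p‖))).congr_deriv ?_
    simp
  have hev : ∀ᶠ t in 𝓝[>] (0 : ℝ), f (x - (0 : ℝ) • p) + L * ‖p‖ * 0 ≤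
      f (x - t • p) + L * ‖p‖ * t := by
    have hc := hline.continuousAt.tendsto
    rw [hx] at hc
    filter_upwards [(hc.mono_left nhdsWithin_le_nhds).eventually h, self_mem_nhdsWithin]
      with t ht htpos
    have htn : ‖x - t • p - x‖ = t * ‖p‖ := by
      rw [sub_sub_cancel_left, norm_neg, norm_smul, Real.norm_of_nonneg (le_of_lt htpos)]
    rw [htn] at ht
    rw [hx]
    linarith
  have := deriv_nonneg_of_eventually_right hder hev
  have hp' : 0 < ‖p‖ := norm_pos_iff.2 hp
  nlinarith

lemma hasDerivAt_time {φ : Euc n × ℝ → ℝ} (hφ : ContDiff ℝ 1 φ) (z : Euc n × ℝ) :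
    HasDerivAt (fun s => φ (z.1, s)) (deriv (fun s => φ (z.1, s)) z.2) z.2 :=
  DifferentiableAt.hasDerivAt <| ((hφ.differentiable one_ne_zero).comp
    (by fun_prop : Differentiable ℝ fun s => (z.1, s))) z.2

lemma hasGradientAt_space {φ : Euc n × ℝ → ℝ} (hφ : ContDiff ℝ 1 φ) (z : Euc n × ℝ) :
    HasGradientAt (fun x => φ (x, z.2)) (gradient (fun x => φ (x, z.2)) z.1) z.1 :=
  DifferentiableAt.hasGradientAt <| ((hφ.differentiable one_ne_zero).comp
    (by fun_prop : Differentiable ℝ fun x => (x, z.2))) z.1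

/-- If the past values of `u` do not exceed its present value, then a smooth function touching `u`
from below has nonnegative time derivative. -/
lemma deriv_time_nonneg {S : Set (Euc n)} {u φ : Euc n × ℝ → ℝ} {z : Euc n × ℝ}
    (hz : z ∈ S ×ˢ Ioi (0 : ℝ)) (hφ : ContDiff ℝ 1 φ)
    (hmin : IsLocalMinOn (fun w => u w - φ w) (S ×ˢ Ioi 0) z)
    (hu : ∀ s, 0 < s → s ≤ z.2 → u (z.1, s) ≤ u z) : 0 ≤ deriv (fun s => φ (z.1, s)) z.2 := by
  refine deriv_nonneg_of_eventually_left (hasDerivAt_time hφ z) ?_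
  have hc : Continuous fun s : ℝ => (z.1, s) := by fun_prop
  have hl : Tendsto (fun s : ℝ => (z.1, s)) (𝓝[<] z.2) (𝓝[S ×ˢ Ioi 0] z) := by
    refine tendsto_nhdsWithin_iff.2 ⟨(hc.tendsto z.2).mono_left nhdsWithin_le_nhds, ?_⟩
    filter_upwards [Ioo_mem_nhdsLT (mem_Ioi.1 hz.2)] with s hs
    exact ⟨hz.1, hs.1⟩
  filter_upwards [hl.eventually hmin, Ioo_mem_nhdsLT (mem_Ioi.1 hz.2)] with s hs hs'
  have := hu s hs'.1 hs'.2.le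
  simp only [Prod.mk.eta]
  linarith

end Calculus

/-! ### The local comparison argument -/

section StrictMaximum

variable {n : ℕ}

/-- The structure of a Hamiltonian used in the comparison principle: convexity in `p`, boundedness
for bounded `p`, and continuity in `x`, locally uniformly on sublevel sets. -/
structure AdmissibleHamiltonian (F : Euc n → Euc n → ℝ) : Prop where
  convex : ∀ x, ConvexOn ℝ univ (F x)
  bdd : ∀ R : ℝ, ∃ C, ∀ x p, ‖p‖ ≤ R → F x p ≤ C
  modulus : ∀ (K : ℝ) (x₀ : Euc n) (η : ℝ), 0 < η → ∃ ρ > 0, ∀ x y, dist x x₀ < ρ →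
    dist y x₀ < ρ → ∀ p, F x p ≤ K → F y p ≤ F x p + η

/-- Near each point of `closure Ω` there is a direction `ν` such that small translations of
`closure Ω` in directions close to `ν` are contained in `Ω`. -/
def HasInwardCone (Ω : Set (Euc n)) : Prop :=
  ∀ x₀ ∈ closure Ω, ∃ (ν : Euc n) (κ : ℝ), 0 < κ ∧ ∀ y ∈ closure Ω, dist y x₀ < κ →
    ∀ δ, 0 < δ → δ < κ → ∀ x, ‖x - y - δ • ν‖ < κ * δ → x ∈ Ω

/-- The evolution operator `u_t + F(x, Du)`. -/
def evolOp (F : Euc n → Euc n → ℝ) : Euc n × ℝ → ℝ → ℝ → Euc n → ℝ := fun z _ a p => a + F z.1 p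

lemma HasInwardCone.eventually_mem {Ω : Set (Euc n)} {x₀ ν : Euc n} {κ : ℝ} (hκ : 0 < κ)
    (hx₀ : x₀ ∈ closure Ω)
    (h : ∀ y ∈ closure Ω, dist y x₀ < κ →
      ∀ δ, 0 < δ → δ < κ → ∀ x, ‖x - y - δ • ν‖ < κ * δ → x ∈ Ω) :
    ∀ᶠ δ in 𝓝[>] (0 : ℝ), x₀ + δ • ν ∈ Ω := by
  filter_upwards [Ioo_mem_nhdsGT hκ] with δ hδ
  refine h x₀ hx₀ (by simpa using hκ) δ hδ.1 hδ.2 _ ?_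
  simpa using mul_pos hκ hδ.1

lemma eventually_mem_closedBall_of_dist_lt {α : Type*} [PseudoMetricSpace α] {z z₀ : α} {τ : ℝ}
    (h : dist z z₀ < τ) (S : Set α) : ∀ᶠ w in 𝓝[S] z, w ∈ Metric.closedBall z₀ τ :=
  mem_nhdsWithin_of_mem_nhds
    (mem_of_superset (Metric.isOpen_ball.mem_nhds h) Metric.ball_subset_closedBall)

/-- A convex combination of a subsolution and a smooth strict subsolution cannot touch a
supersolution from below at a strict local maximum point of the difference. -/
lemma no_strict_max {Ω : Set (Euc n)} (hcone : HasInwardCone Ω) {F : Euc n → Euc n → ℝ}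
    (hF : AdmissibleHamiltonian F) {u v ψ : Euc n × ℝ → ℝ} {K C μ τ : ℝ} {z₀ : Euc n × ℝ}
    (hu : ContinuousOn u (closure Ω ×ˢ Ici 0)) (hv : ContinuousOn v (closure Ω ×ˢ Ici 0))
    (hsub : ViscSub (Ω ×ˢ Ioi 0) (Ω ×ˢ Ioi 0) (evolOp F) u)
    (hsubK : ViscSub (Ω ×ˢ Ioi 0) (Ω ×ˢ Ioi 0) (fun z _ _ p => F z.1 p - K) u)
    (hsuper : ViscSuper (closure Ω ×ˢ Ioi 0) (closure Ω ×ˢ Ioi 0) (evolOp F) v)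
    (hC : ∀ x p, ‖p‖ ≤ 2 → F x p ≤ C) (hμ0 : 0 < μ) (hμ1 : μ < 1) (hψ : ContDiff ℝ 1 ψ)
    (hψt : ∀ z, dist z z₀ < τ → deriv (fun s => ψ (z.1, s)) z.2 ≤ -(C + 1))
    (hψx : ∀ z : Euc n × ℝ, ‖gradient (fun x => ψ (x, z.2)) z.1‖ ≤ 2)
    (hz₀ : z₀.1 ∈ closure Ω) (hτ : 0 < τ) (hτz : τ < z₀.2)
    (hmax : ∀ z ∈ closure Ω ×ˢ Ici (0 : ℝ), dist z z₀ ≤ τ →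
      (1 - μ) * u z₀ + μ * ψ z₀ - v z₀ ≤ (1 - μ) * u z + μ * ψ z - v z → z = z₀) : False := by
  obtain ⟨ν, κ, hκ, hν⟩ := hcone z₀.1 hz₀
  set S : Set (Euc n × ℝ) := closure Ω ×ˢ Ici 0 with hS
  set A : Set (Euc n × ℝ) := S ∩ Metric.closedBall z₀ τ with hA
  have hAc : IsCompact A :=
    (isCompact_closedBall z₀ τ).inter_left (isClosed_closure.prod isClosed_Ici)
  have hz₀S : z₀ ∈ S := ⟨hz₀, (hτ.trans hτz).le⟩
  have hz₀A : z₀ ∈ A := ⟨hz₀S, Metric.mem_closedBall_self hτ.le⟩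
  -- The level `|K| + |C|` will bound the Hamiltonian at the subsolution's point. The error `μ / 2`
  -- is half of the strictness `μ` gained from `ψ`.
  obtain ⟨ρ₀, hρ₀, hmod⟩ := hF.modulus (|K| + |C|) z₀.1 (μ / 2) (by positivity)
  have hν' : ∀ᶠ δ in 𝓝[>] (0 : ℝ), z₀ + δ • ((ν, 0) : Euc n × ℝ) ∈ A := by
    have h1 : Tendsto (fun δ : ℝ => z₀ + δ • ((ν, 0) : Euc n × ℝ)) (𝓝[>] 0) (𝓝 z₀) := by
      have : Continuous fun δ : ℝ => z₀ + δ • ((ν, 0) : Euc n × ℝ) := by fun_prop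
      simpa using (this.tendsto 0).mono_left nhdsWithin_le_nhds
    filter_upwards [h1.eventually (Metric.closedBall_mem_nhds z₀ hτ),
      HasInwardCone.eventually_mem hκ hz₀ hν] with δ h2 h3
    refine ⟨⟨subset_closure ?_, ?_⟩, h2⟩
    · simpa using h3
    · simpa using (hτ.trans hτz).le
  -- The shift is purely spatial. The penalty is a sum of squares because the product norm, a
  -- maximum, is not smooth.
  obtain ⟨δ, hδ0, hδ, ⟨x, t⟩, hxA, ⟨y, s⟩, hyA, hy0, hx0, hxy, hM⟩ :=
    exists_isMaxOn_penalized (f := fun z => (1 - μ) * u z + μ * ψ z) (h := v) (ι := id)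
      (N := fun w : Euc n × ℝ => ‖w.1‖ ^ 2 + w.2 ^ 2) (ν := (ν, 0))
      hAc hAc
      ((continuousOn_const.mul (hu.mono inter_subset_left)).add
        (continuousOn_const.mul hψ.continuous.continuousOn))
      (hv.mono inter_subset_left) continuous_id (by fun_prop) (by simp)
      (fun w => by
        rcases max_cases ‖w.1‖ ‖w.2‖ with h | h <;> rw [Prod.norm_def, h.1]
        · nlinarith [sq_nonneg w.2]
        · rw [Real.norm_eq_abs, sq_abs]; nlinarith [sq_nonneg ‖w.1‖])
      hz₀A hz₀A (fun z hz _ h => hmax z hz.1 hz.2 h) hν'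
      (ρ := min (min ρ₀ τ) κ) (by positivity)
  have hρτ : min (min ρ₀ τ) κ ≤ τ := (min_le_left _ _).trans (min_le_right _ _)
  have hρρ : min (min ρ₀ τ) κ ≤ ρ₀ := (min_le_left _ _).trans (min_le_left _ _)
  have hρκ : min (min ρ₀ τ) κ ≤ κ := min_le_right _ _
  have hx1 : dist x z₀.1 < min (min ρ₀ τ) κ := (le_max_left _ _).trans_lt hx0
  have hx2 : dist t z₀.2 < min (min ρ₀ τ) κ := (le_max_right _ _).trans_lt hx0
  have hy1 : dist y z₀.1 < min (min ρ₀ τ) κ := (le_max_left _ _).trans_lt hy0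
  have hy2 : dist s z₀.2 < min (min ρ₀ τ) κ := (le_max_right _ _).trans_lt hy0
  have ht : 0 < t := by rw [Real.dist_eq] at hx2; linarith [(abs_lt.1 (hx2.trans_le hρτ)).1]
  have hs : 0 < s := by rw [Real.dist_eq] at hy2; linarith [(abs_lt.1 (hy2.trans_le hρτ)).1]
  have hxΩ : x ∈ Ω := by
    refine hν y hyA.1.1 (hy1.trans_le hρκ) δ hδ0 (hδ.trans_le hρκ) x ?_
    have h1 : ‖x - y - δ • ν‖ ≤ ‖(x, t) - id (y, s) - δ • ((ν, 0) : Euc n × ℝ)‖ :=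
      le_trans (by simp) (norm_fst_le _)
    exact h1.trans_lt (hxy.trans_le (mul_le_mul_of_nonneg_right hρκ hδ0.le))
  simp only [id, Prod.mk_sub_mk, Prod.smul_mk, sub_zero, smul_eq_mul, Prod.forall] at hM
  set p : Euc n := (2 * δ⁻¹) • (δ⁻¹ • (x - y) - ν) with hp
  set a : ℝ := 2 * δ⁻¹ * (δ⁻¹ * (t - s)) with ha
  have hl : 0 < 1 - μ := by linarith
  -- the test function for the subsolution
  set φ : Euc n × ℝ → ℝ := fun z => (1 - μ)⁻¹ *
    (‖δ⁻¹ • (z.1 - y) - ν‖ ^ 2 + (δ⁻¹ * (z.2 - s)) ^ 2 - μ * ψ z) with hφ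
  have hφC : ContDiff ℝ 1 φ := by
    refine contDiff_const.mul ((ContDiff.add (ContDiff.norm_sq ℝ ?_) ?_).sub
      (contDiff_const.mul hψ)) <;> fun_prop
  have hφmax : IsLocalMaxOn (fun z => u z - φ z) (Ω ×ˢ Ioi 0) (x, t) := by
    filter_upwards [eventually_mem_closedBall_of_dist_lt (hx0.trans_le hρτ) (Ω ×ˢ Ioi 0),
      self_mem_nhdsWithin] with z hz hzΩ
    have h1 := hM z.1 z.2 ⟨⟨subset_closure hzΩ.1, Ioi_subset_Ici_self hzΩ.2⟩, hz⟩ y s hyA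
    have h2 : ∀ z, (1 - μ) * (u z - φ z) = (1 - μ) * u z + μ * ψ z -
        (‖δ⁻¹ • (z.1 - y) - ν‖ ^ 2 + (δ⁻¹ * (z.2 - s)) ^ 2) := by
      intro z
      simp only [hφ]
      field_simp
      ring
    refine le_of_mul_le_mul_left ?_ hl
    rw [h2, h2]
    simp only [Prod.mk.eta] at h1 ⊢
    linarith
  have hψgrad : HasGradientAt (fun x => ψ (x, t)) (gradient (fun x => ψ (x, t)) x) x :=
    hasGradientAt_space hψ (x, t)
  have hψder : HasDerivAt (fun s => ψ (x, s)) (deriv (fun s => ψ (x, s)) t) t :=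
    hasDerivAt_time hψ (x, t)
  have hq1 := hψx (x, t)
  have hr1 := hψt (x, t) (hx0.trans_le hρτ)
  simp only at hq1 hr1
  set q := gradient (fun x => ψ (x, t)) x
  set r := deriv (fun s => ψ (x, s)) t
  have hφgrad : gradient (fun x => φ (x, t)) x = (1 - μ)⁻¹ • (p - μ • q) := by
    apply HasGradientAt.gradient
    rw [hasGradientAt_iff_hasFDerivAt] at hψgrad ⊢
    have h1 := (hasGradientAt_penalty δ⁻¹ y ν x).hasFDerivAt
    refine (((h1.add_const ((δ⁻¹ * (t - s)) ^ 2)).sub (hψgrad.const_mul μ)).const_mul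
      (1 - μ)⁻¹).congr_fderiv ?_
    simp [hp]
  have hφder : deriv (fun s => φ (x, s)) t = (1 - μ)⁻¹ * (a - μ * r) := by
    apply HasDerivAt.deriv
    have h1 : HasDerivAt (fun t => (δ⁻¹ * (t - s)) ^ 2) a t :=
      ((((hasDerivAt_id t).sub_const s).const_mul δ⁻¹).pow 2).congr_deriv (by simp [ha]; ring)
    exact ((h1.const_add (‖δ⁻¹ • (x - y) - ν‖ ^ 2)).sub (hψder.const_mul μ)).const_mul (1 - μ)⁻¹
  have hsub1 := hsub (x, t) ⟨hxΩ, ht⟩ φ hφC hφmax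
  have hsub2 := hsubK (x, t) ⟨hxΩ, ht⟩ φ hφC hφmax
  simp only [evolOp, hφgrad, hφder] at hsub1 hsub2
  -- the test function for the supersolution
  have hχC : ContDiff ℝ 1 fun z : Euc n × ℝ =>
      -‖δ⁻¹ • (x - z.1) - ν‖ ^ 2 - (δ⁻¹ * (t - z.2)) ^ 2 := by
    refine (ContDiff.neg (ContDiff.norm_sq ℝ ?_)).sub ?_ <;> fun_prop
  have hχmin : IsLocalMinOn (fun z => v z -
      (fun z : Euc n × ℝ => -‖δ⁻¹ • (x - z.1) - ν‖ ^ 2 - (δ⁻¹ * (t - z.2)) ^ 2) z)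
      (closure Ω ×ˢ Ioi 0) (y, s) := by
    filter_upwards [eventually_mem_closedBall_of_dist_lt (hy0.trans_le hρτ) (closure Ω ×ˢ Ioi 0),
      self_mem_nhdsWithin] with z hz hzΩ
    have h1 := hM x t hxA z.1 z.2 ⟨⟨hzΩ.1, Ioi_subset_Ici_self hzΩ.2⟩, hz⟩
    simp only [Prod.mk.eta] at h1 ⊢
    linarith
  have hχgrad : gradient (fun y => -‖δ⁻¹ • (x - y) - ν‖ ^ 2 - (δ⁻¹ * (t - s)) ^ 2) y = p := by
    apply HasGradientAt.gradient
    rw [hasGradientAt_iff_hasFDerivAt]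
    exact (hasGradientAt_penalty_right δ⁻¹ x ν y).hasFDerivAt.sub_const _
  have hχder : deriv (fun s => -‖δ⁻¹ • (x - y) - ν‖ ^ 2 - (δ⁻¹ * (t - s)) ^ 2) s = a := by
    apply HasDerivAt.deriv
    exact (((((hasDerivAt_id s).const_sub t).const_mul δ⁻¹).pow 2).const_sub _).congr_deriv
      (by simp [ha]; ring)
  have hsup := hsuper (y, s) ⟨hyA.1.1, hs⟩ _ hχC hχmin
  simp only [evolOp, hχgrad, hχder] at hsup
  -- convexity and conclusion
  have hconv := (hF.convex x).2 (mem_univ ((1 - μ)⁻¹ • (p - μ • q))) (mem_univ q) hl.le hμ0.le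
    (by ring)
  rw [smul_smul, mul_inv_cancel₀ hl.ne', one_smul, sub_add_cancel, smul_eq_mul, smul_eq_mul]
    at hconv
  set f := F x ((1 - μ)⁻¹ • (p - μ • q))
  have hq := hC x q hq1
  have h1 : a - μ * r + (1 - μ) * f ≤ 0 := by
    have : (1 - μ) * ((1 - μ)⁻¹ * (a - μ * r) + f) ≤ 0 :=
      mul_nonpos_of_nonneg_of_nonpos hl.le hsub1
    rwa [mul_add, mul_inv_cancel_left₀ hl.ne'] at this
  have hFx : F x p ≤ |K| + |C| := by
    have h3 : (1 - μ) * f ≤ |K| := by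
      nlinarith [le_abs_self K, abs_nonneg K]
    have h4 : μ * F x q ≤ |C| := by
      nlinarith [le_abs_self C, abs_nonneg C]
    linarith
  -- Convexity and the subsolution inequality give `a + F x p ≤ μ * (r + C) ≤ -μ`. Moving from `x`
  -- to `y` costs at most `μ / 2`, so `a + F y p < 0`, against the supersolution inequality.
  have h2 := hmod x y (hx1.trans_le hρρ) (hy1.trans_le hρρ) p hFx
  nlinarith

end StrictMaximum

/-! ### Comparison when the Hamiltonian is bounded along the subsolution -/

section BoundedComparison

variable {n : ℕ}

/-- Comparison for the state-constraint problem, for a subsolution along which the Hamiltonian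
stays bounded. -/
theorem comparison_of_bounded {Ω : Set (Euc n)} (hcone : HasInwardCone Ω)
    {F : Euc n → Euc n → ℝ} (hF : AdmissibleHamiltonian F) {g : Euc n → ℝ}
    {u v : Euc n × ℝ → ℝ} {K : ℝ} (hu : InClass (closure Ω) g u) (hv : InClass (closure Ω) g v)
    (hsub : ViscSub (Ω ×ˢ Ioi 0) (Ω ×ˢ Ioi 0) (evolOp F) u)
    (hsubK : ViscSub (Ω ×ˢ Ioi 0) (Ω ×ˢ Ioi 0) (fun z _ _ p => F z.1 p - K) u)
    (hsuper : ViscSuper (closure Ω ×ˢ Ioi 0) (closure Ω ×ˢ Ioi 0) (evolOp F) v)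
    {x₁ : Euc n} (hx₁ : x₁ ∈ closure Ω) {t₁ : ℝ} (ht₁ : 0 ≤ t₁) : u (x₁, t₁) ≤ v (x₁, t₁) := by
  by_contra! hlt
  obtain ⟨Bu, hBu⟩ := hu.bdd (t₁ + 1)
  obtain ⟨Bv, hBv⟩ := hv.bdd (t₁ + 1)
  obtain ⟨C₀, hC₀⟩ := hF.bdd 2
  set T := t₁ + 1 with hT
  set B := max Bu Bv with hB
  have hub : ∀ x ∈ closure Ω, ∀ t ∈ Icc 0 T, |u (x, t)| ≤ B := fun x hx t ht =>
    (hBu x hx t ht).trans (le_max_left _ _)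
  have hvb : ∀ x ∈ closure Ω, ∀ t ∈ Icc 0 T, |v (x, t)| ≤ B := fun x hx t ht =>
    (hBv x hx t ht).trans (le_max_right _ _)
  have ht₁T : t₁ ∈ Icc 0 T := ⟨ht₁, by linarith⟩
  have hB0 : 0 ≤ B := (abs_nonneg _).trans (hub x₁ hx₁ t₁ ht₁T)
  set C := max C₀ 0 with hCdef
  have hC : ∀ x p, ‖p‖ ≤ 2 → F x p ≤ C := fun x p hp => (hC₀ x p hp).trans (le_max_left _ _)
  have hC0 : 0 ≤ C := le_max_right _ _
  -- The strict subsolution needs time slope at most `-(C + 1)`; the extra `2 * T` absorbs the slope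
  -- of the localizing term `-(t - t₀) ^ 2`.
  set D := C + 1 + 2 * T with hD
  have hD0 : 0 ≤ D := by linarith
  set θ := u (x₁, t₁) - v (x₁, t₁) with hθ
  have hθ0 : 0 < θ := by linarith
  -- `μ * Q` bounds the loss at `(x₁, t₁)` from mixing in `ψ₁`; with `μ * Q < θ` the mixed
  -- difference stays positive there.
  set Q := 2 * B + smoothNorm x₁ + D * t₁ + 1 with hQ
  have hQ0 : 1 ≤ Q := by
    have := one_le_smoothNorm x₁
    have := mul_nonneg hD0 ht₁
    linarith
  obtain ⟨μ, hμ0, hμ1, hμQ⟩ : ∃ μ : ℝ, 0 < μ ∧ μ < 1 ∧ μ * Q < θ := by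
    refine ⟨min (1 / 2) (θ / (2 * Q)), by positivity, (min_le_left _ _).trans_lt (by norm_num), ?_⟩
    calc min (1 / 2) (θ / (2 * Q)) * Q ≤ θ / (2 * Q) * Q := by gcongr; exact min_le_right _ _
      _ = θ / 2 := by field_simp
      _ < θ := by linarith
  -- With `μ * N = 2 * B` the mixed difference is negative both for `‖x‖ ≥ N` and at `t = T`, where
  -- the exponential equals `exp N ≥ N + 1`.
  set N := 2 * B / μ with hN
  have hN0 : 0 ≤ N := by positivity
  have hμN : μ * N = 2 * B := by rw [hN]; field_simp
  -- The four terms serve in turn to keep `ψ₁` below `u`, to confine the maximum in space, to give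
  -- strictness, and to keep the maximum away from `t = T`.
  set ψ₁ : Euc n × ℝ → ℝ := fun z =>
    -(B + smoothNorm (z.1 - 0) + D * z.2 + Real.exp (N * (z.2 - t₁))) with hψ₁
  set m : Euc n × ℝ → ℝ := fun z => (1 - μ) * u z + μ * ψ₁ z - v z with hm
  have hψ₁C : ContDiff ℝ 1 ψ₁ := by
    refine ((((contDiff_const.add (contDiff_smoothNorm.comp ?_)).add ?_)).add ?_).neg <;> fun_prop
  have hmc : ContinuousOn m (closure Ω ×ˢ Ici 0) :=
    ((continuousOn_const.mul hu.cont).add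
      (continuousOn_const.mul hψ₁C.continuous.continuousOn)).sub hv.cont
  have hm₁ : 0 < m (x₁, t₁) := by
    have h1 := abs_le.1 (hub x₁ hx₁ t₁ ht₁T)
    have h2 : m (x₁, t₁) = θ + μ * (-u (x₁, t₁) - (B + smoothNorm x₁ + D * t₁ + 1)) := by
      simp only [hm, hψ₁, hθ, sub_self, mul_zero, Real.exp_zero, sub_zero]; ring
    rw [h2]
    have h3 : μ * -Q ≤ μ * (-u (x₁, t₁) - (B + smoothNorm x₁ + D * t₁ + 1)) :=
      mul_le_mul_of_nonneg_left (by linarith) hμ0.le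
    linarith
  have hmle : ∀ x ∈ closure Ω, ∀ t ∈ Icc 0 T,
      m (x, t) < 2 * B - μ * ‖x‖ ∧ m (x, t) ≤ 2 * B - μ * Real.exp (N * (t - t₁)) := by
    intro x hx t ht
    have h1 := abs_le.1 (hub x hx t ht)
    have h2 := abs_le.1 (hvb x hx t ht)
    have h3 : (1 - μ) * u (x, t) ≤ (1 - μ) * B := mul_le_mul_of_nonneg_left h1.2 (by linarith)
    have h4 : m (x, t) = (1 - μ) * u (x, t) - v (x, t) - μ * B - μ * smoothNorm x - μ * (D * t) -
        μ * Real.exp (N * (t - t₁)) := by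
      simp only [hm, hψ₁, sub_zero]; ring
    have h5 : 0 ≤ μ * (D * t) := mul_nonneg hμ0.le (mul_nonneg hD0 ht.1)
    have h6 : 0 < μ * Real.exp (N * (t - t₁)) := mul_pos hμ0 (Real.exp_pos _)
    have h7 : μ * ‖x‖ ≤ μ * smoothNorm x := mul_le_mul_of_nonneg_left (norm_le_smoothNorm x) hμ0.le
    have h8 : 0 ≤ μ * ‖x‖ := by positivity
    have h9 : 0 ≤ μ * B := by positivity
    constructor <;> nlinarith
  set A : Set (Euc n × ℝ) := (closure Ω ∩ Metric.closedBall 0 (max N ‖x₁‖)) ×ˢ Icc 0 T with hA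
  have hAc : IsCompact A :=
    ((isCompact_closedBall _ _).inter_left isClosed_closure).prod isCompact_Icc
  obtain ⟨⟨x₀, t₀⟩, ⟨⟨hx₀, hx₀R⟩, ht₀⟩, hmax⟩ := hAc.exists_isMaxOn
    ⟨(x₁, t₁), ⟨hx₁, by simp⟩, ht₁T⟩ (hmc.mono (prod_mono inter_subset_left Icc_subset_Ici_self))
  simp only at hx₀ ht₀
  have hm₀ : 0 < m (x₀, t₀) :=
    hm₁.trans_le (hmax (show (x₁, t₁) ∈ A from ⟨⟨hx₁, by simp⟩, ht₁T⟩))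
  have hglob : ∀ x ∈ closure Ω, ∀ t ∈ Icc 0 T, m (x, t) ≤ m (x₀, t₀) := by
    intro x hx t ht
    by_cases hxN : ‖x‖ ≤ max N ‖x₁‖
    · exact hmax (show (x, t) ∈ A from ⟨⟨hx, by simpa using hxN⟩, ht⟩)
    · have h1 := (hmle x hx t ht).1
      have h2 : N ≤ ‖x‖ := (le_max_left _ _).trans (not_le.1 hxN).le
      have h3 := mul_le_mul_of_nonneg_left h2 hμ0.le
      linarith
  have ht₀0 : 0 < t₀ := by
    refine lt_of_le_of_ne ht₀.1 fun h => ?_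
    subst h
    have h1 := (abs_le.1 (hub x₀ hx₀ 0 ht₀)).1
    have h2 : v (x₀, 0) = u (x₀, 0) := by rw [hu.init _ hx₀, hv.init _ hx₀]
    have h3 : m (x₀, 0) = -(μ * (u (x₀, 0) + B + smoothNorm x₀ + Real.exp (N * (0 - t₁)))) := by
      simp only [hm, hψ₁, h2, sub_zero]; ring
    have h4 : 0 < u (x₀, 0) + B + smoothNorm x₀ + Real.exp (N * (0 - t₁)) := by
      have := one_le_smoothNorm x₀
      have := Real.exp_pos (N * (0 - t₁))
      linarith
    have := mul_pos hμ0 h4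
    linarith
  have ht₀T : t₀ < T := by
    refine lt_of_le_of_ne ht₀.2 fun h => ?_
    have h1 := (hmle x₀ hx₀ t₀ ht₀).2
    have h2 : N * (t₀ - t₁) = N := by rw [h, hT]; ring
    rw [h2] at h1
    have h3 := mul_le_mul_of_nonneg_left (Real.add_one_le_exp N) hμ0.le
    linarith
  -- localize around the maximum point
  set ψ : Euc n × ℝ → ℝ := fun z => ψ₁ z - (smoothNorm (z.1 - x₀) - 1) - (z.2 - t₀) ^ 2 with hψ
  have hψC : ContDiff ℝ 1 ψ := by
    refine (hψ₁C.sub ((contDiff_smoothNorm.comp ?_).sub contDiff_const)).sub ?_ <;> fun_prop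
  set τ := min t₀ (T - t₀) / 2 with hτ
  have hτ0 : 0 < τ := by have := sub_pos.2 ht₀T; positivity
  have hτ1 : 2 * τ ≤ t₀ := by have := min_le_left t₀ (T - t₀); linarith
  have hτ2 : 2 * τ ≤ T - t₀ := by have := min_le_right t₀ (T - t₀); linarith
  have hdist : ∀ z : Euc n × ℝ, dist z (x₀, t₀) ≤ τ → z.2 ∈ Icc 0 T := by
    intro z hz
    have h1 : |z.2 - t₀| ≤ τ := (le_max_right _ _).trans hz
    have h2 := abs_le.1 h1
    constructor <;> linarith
  refine no_strict_max (z₀ := (x₀, t₀)) (τ := τ) hcone hF hu.cont hv.cont hsub hsubK hsuper hC hμ0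
    hμ1 hψC ?_ ?_ hx₀ hτ0 (by simp only; linarith) ?_
  · intro z hz
    have h1 : HasDerivAt (fun s => Real.exp (N * (s - t₁))) (Real.exp (N * (z.2 - t₁)) * N) z.2 := by
      simpa using (((hasDerivAt_id z.2).sub_const t₁).const_mul N).exp
    have h2 : HasDerivAt (fun s => ψ₁ (z.1, s)) (-(D + Real.exp (N * (z.2 - t₁)) * N)) z.2 := by
      have h3 : HasDerivAt (fun s => B + smoothNorm (z.1 - 0) + D * s) D z.2 := by
        simpa using ((hasDerivAt_id z.2).const_mul D).const_add (B + smoothNorm (z.1 - 0))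
      exact (h3.add h1).neg
    have h3 : HasDerivAt (fun s => (s - t₀) ^ 2) (2 * (z.2 - t₀)) z.2 :=
      (((hasDerivAt_id z.2).sub_const t₀).pow 2).congr_deriv (by simp)
    have h4 : HasDerivAt (fun s => ψ (z.1, s))
        (-(D + Real.exp (N * (z.2 - t₁)) * N) - 2 * (z.2 - t₀)) z.2 :=
      (h2.sub_const (smoothNorm (z.1 - x₀) - 1)).sub h3
    rw [h4.deriv]
    have h5 := (hdist z hz.le).1
    have h6 := mul_nonneg (Real.exp_pos (N * (z.2 - t₁))).le hN0
    linarith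
  · intro z
    obtain ⟨p, hp, hpg⟩ := exists_hasGradientAt_smoothNorm 0 z.1
    obtain ⟨q, hq, hqg⟩ := exists_hasGradientAt_smoothNorm x₀ z.1
    have h1 : HasGradientAt (fun x => ψ (x, z.2)) (-p - q) z.1 := by
      rw [hasGradientAt_iff_hasFDerivAt] at hpg hqg ⊢
      refine ((((((hpg.const_add B).add_const (D * z.2)).add_const
        (Real.exp (N * (z.2 - t₁)))).neg).sub (hqg.sub_const 1)).sub_const
        ((z.2 - t₀) ^ 2)).congr_fderiv ?_
      simp
    rw [h1.gradient]
    calc ‖-p - q‖ ≤ ‖-p‖ + ‖q‖ := norm_sub_le _ _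
      _ ≤ 2 := by rw [norm_neg]; linarith
  · rintro ⟨x, t⟩ ⟨hx, -⟩ hz hle
    have h1 := hglob x hx t (hdist _ hz)
    have h2 := one_le_smoothNorm (x - x₀)
    have h3 := sq_nonneg (t - t₀)
    have h4 : smoothNorm (x₀ - x₀) = 1 := by simp [smoothNorm]
    have h5 : μ * ((smoothNorm (x - x₀) - 1) + (t - t₀) ^ 2) ≤ 0 := by
      simp only [hψ, hm, h4] at hle h1
      nlinarith
    have h6 : (smoothNorm (x - x₀) - 1) + (t - t₀) ^ 2 ≤ 0 := by
      by_contra! h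
      linarith [mul_pos hμ0 h]
    have h7 : x = x₀ := sub_eq_zero.1 (eq_zero_of_smoothNorm_le_one (by linarith))
    have h8 : t = t₀ := by
      have : (t - t₀) ^ 2 = 0 := le_antisymm (by linarith) h3
      exact sub_eq_zero.1 (pow_eq_zero_iff two_ne_zero |>.1 this)
    rw [h7, h8]

end BoundedComparison

/-! ### Monotonicity in time -/

section Comparison

variable {n : ℕ}

lemma tendsto_timeShift {Ω : Set (Euc n)} {x : Euc n} {s d : ℝ} (h : 0 < s + d) :
    Tendsto (fun w : Euc n × ℝ => (w.1, w.2 + d)) (𝓝[Ω ×ˢ Ioi 0] (x, s))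
      (𝓝[Ω ×ˢ Ioi 0] (x, s + d)) := by
  have hc : Continuous fun w : Euc n × ℝ => (w.1, w.2 + d) := by fun_prop
  have hl := (hc.tendsto (x, s)).mono_left (nhdsWithin_le_nhds (s := Ω ×ˢ Ioi 0))
  refine tendsto_nhdsWithin_iff.2 ⟨hl, ?_⟩
  filter_upwards [hl.eventually ((isOpen_univ.prod isOpen_Ioi).mem_nhds
    (show (x, s + d) ∈ univ ×ˢ Ioi (0 : ℝ) from ⟨trivial, h⟩)), self_mem_nhdsWithin] with w h1 h2
  exact ⟨h2.1, h1.2⟩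

lemma IsLocalMaxOn.isLocalMax_of_prod {Ω : Set (Euc n)} (hΩ : IsOpen Ω) {f : Euc n × ℝ → ℝ}
    {z : Euc n × ℝ} (hz : z ∈ Ω ×ˢ Ioi (0 : ℝ)) (h : IsLocalMaxOn f (Ω ×ˢ Ioi 0) z) :
    IsLocalMax f z :=
  h.isLocalMax ((hΩ.prod isOpen_Ioi).mem_nhds hz)

lemma admissibleHamiltonian_zero : AdmissibleHamiltonian (fun _ _ : Euc n => (0 : ℝ)) where
  convex _ := convexOn_const 0 convex_univ
  bdd _ := ⟨0, fun _ _ _ => le_rfl⟩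
  modulus _ _ η hη := ⟨1, one_pos, fun _ _ _ _ _ _ => by linarith⟩

/-- Subsolutions for a nonnegative Hamiltonian are nonincreasing in time. -/
theorem antitone_of_viscSub {Ω : Set (Euc n)} (hcone : HasInwardCone Ω)
    {F : Euc n → Euc n → ℝ} (hF0 : ∀ x p, 0 ≤ F x p) {g : Euc n → ℝ} {u : Euc n × ℝ → ℝ}
    (hu : InClass (closure Ω) g u)
    (hsub : ViscSub (Ω ×ˢ Ioi 0) (Ω ×ˢ Ioi 0) (evolOp F) u)
    {x : Euc n} (hx : x ∈ closure Ω) {s t : ℝ} (hs : 0 ≤ s) (hst : s ≤ t) :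
    u (x, t) ≤ u (x, s) := by
  have h0 : ViscSub (Ω ×ˢ Ioi 0) (Ω ×ˢ Ioi 0) (evolOp fun _ _ => (0 : ℝ))
      fun z => u (z.1, z.2 + s) := by
    intro z hz φ hφ hmax
    have hzs : 0 < z.2 + s := add_pos_of_pos_of_nonneg hz.2 hs
    have hmax' : IsLocalMaxOn (fun w => u w - φ (w.1, w.2 + -s)) (Ω ×ˢ Ioi 0) (z.1, z.2 + s) := by
      have h1 : 0 < z.2 + s + -s := by simpa using hz.2
      have h2 := tendsto_timeShift (Ω := Ω) (x := z.1) h1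
      rw [add_neg_cancel_right] at h2
      filter_upwards [h2.eventually hmax] with w hw
      simpa using hw
    have h1 := hsub (z.1, z.2 + s) ⟨hz.1, hzs⟩ (fun w => φ (w.1, w.2 + -s))
      (hφ.comp (by fun_prop)) hmax'
    simp only [evolOp, deriv_comp_add_const (fun s => φ (z.1, s)), add_neg_cancel_right] at h1 ⊢
    linarith [hF0 z.1 (gradient (fun x => φ (x, z.2)) z.1)]
  -- Dropping `F ≥ 0` leaves `w_t ≤ 0` for the time shift `w` of `u`. It is compared with the slice
  -- at time `s`, frozen in time, under the zero Hamiltonian, where boundedness is automatic.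
  have h1 := comparison_of_bounded (g := fun x => u (x, s)) (u := fun z => u (z.1, z.2 + s))
    (v := fun z => u (z.1, s)) (K := 0) hcone admissibleHamiltonian_zero
    ⟨hu.cont.comp (by fun_prop) fun z hz => ⟨hz.1, add_nonneg hz.2 hs⟩, fun T => by
      obtain ⟨C, hC⟩ := hu.bdd (T + s)
      exact ⟨C, fun x hx t ht => hC x hx _ ⟨add_nonneg ht.1 hs, by linarith [ht.2]⟩⟩,
      fun x hx => by simp⟩
    ⟨hu.cont.comp (by fun_prop) fun z hz => ⟨hz.1, hs⟩, fun T => by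
      obtain ⟨C, hC⟩ := hu.bdd s
      exact ⟨C, fun x hx t ht => hC x hx _ ⟨hs, le_rfl⟩⟩,
      fun x hx => rfl⟩ h0 (fun z _ φ _ _ => by simp) ?_ hx (sub_nonneg.2 hst)
  · simpa using h1
  · intro z hz φ hφ hmin
    simpa only [evolOp, add_zero] using deriv_time_nonneg hz hφ hmin fun _ _ _ => le_rfl

/-! ### Regularization in time -/

/-- The smallest majorant of `u` that decreases in time at most with speed `K`:
`max_{0 ≤ s ≤ t} (u(x, s) - K (t - s))`. -/
noncomputable def lipEnvelope (K : ℝ) (u : Euc n × ℝ → ℝ) (z : Euc n × ℝ) : ℝ :=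
  sSup ((fun σ : ℝ => u (z.1, σ * z.2) - K * (z.2 - σ * z.2)) '' Icc 0 1)

section Envelope

variable {S : Set (Euc n)} {u : Euc n × ℝ → ℝ} (K : ℝ)

lemma continuousOn_slice (hu : ContinuousOn u (S ×ˢ Ici 0)) {z : Euc n × ℝ}
    (hz : z ∈ S ×ˢ Ici (0 : ℝ)) :
    ContinuousOn (fun σ : ℝ => u (z.1, σ * z.2) - K * (z.2 - σ * z.2)) (Icc 0 1) := by
  refine ContinuousOn.sub (hu.comp (by fun_prop) fun σ hσ => ⟨hz.1, mul_nonneg hσ.1 hz.2⟩) ?_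
  fun_prop

lemma exists_lipEnvelope_eq (hu : ContinuousOn u (S ×ˢ Ici 0)) {x : Euc n} (hx : x ∈ S) {t : ℝ}
    (ht : 0 ≤ t) : ∃ s ∈ Icc 0 t, lipEnvelope K u (x, t) = u (x, s) - K * (t - s) := by
  obtain ⟨σ, hσ, h⟩ := (isCompact_Icc (a := (0 : ℝ)) (b := 1)).exists_sSup_image_eq
    (nonempty_Icc.2 zero_le_one)
    (continuousOn_slice K hu (show (x, t) ∈ S ×ˢ Ici (0 : ℝ) from ⟨hx, ht⟩))
  exact ⟨σ * t, ⟨mul_nonneg hσ.1 ht, mul_le_of_le_one_left ht hσ.2⟩, h⟩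

lemma le_lipEnvelope (hu : ContinuousOn u (S ×ˢ Ici 0)) {x : Euc n} (hx : x ∈ S) {s t : ℝ}
    (hs : 0 ≤ s) (hst : s ≤ t) : u (x, s) - K * (t - s) ≤ lipEnvelope K u (x, t) := by
  have hb := ((isCompact_Icc (a := (0 : ℝ)) (b := 1)).image_of_continuousOn (continuousOn_slice K hu
    (show (x, t) ∈ S ×ˢ Ici (0 : ℝ) from ⟨hx, hs.trans hst⟩))).bddAbove
  rcases (hs.trans hst).eq_or_lt with rfl | ht
  · obtain rfl : s = 0 := le_antisymm hst hs
    exact le_csSup hb ⟨0, by simp, by simp⟩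
  · refine le_csSup hb ⟨s / t, ⟨div_nonneg hs ht.le, div_le_one_of_le₀ hst ht.le⟩, ?_⟩
    simp [div_mul_cancel₀ _ ht.ne']

/-- Parametrizing the past times as `σ t` turns the envelope into a supremum over a compact set that
does not depend on the point. -/
lemma continuousOn_lipEnvelope (hu : ContinuousOn u (S ×ˢ Ici 0)) :
    ContinuousOn (lipEnvelope K u) (S ×ˢ Ici 0) := by
  rw [continuousOn_iff_continuous_domRestrict]
  have h : Continuous fun q : (S ×ˢ Ici (0 : ℝ) : Set (Euc n × ℝ)) × Icc (0 : ℝ) 1 =>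
      u (q.1.1.1, q.2.1 * q.1.1.2) - K * (q.1.1.2 - q.2.1 * q.1.1.2) := by
    refine Continuous.sub (hu.comp_continuous (by fun_prop) fun q =>
      ⟨q.1.2.1, mul_nonneg q.2.2.1 q.1.2.2⟩) ?_
    fun_prop
  have h1 := isCompact_univ.continuous_sSup (f := fun (z : (S ×ˢ Ici (0 : ℝ) : Set (Euc n × ℝ)))
    (σ : Icc (0 : ℝ) 1) => u (z.1.1, σ.1 * z.1.2) - K * (z.1.2 - σ.1 * z.1.2)) h
  refine h1.congr fun z => ?_
  rw [domRestrict_apply, lipEnvelope]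
  congr 1
  ext r
  simp

lemma inClass_lipEnvelope {g : Euc n → ℝ} (hK : 0 ≤ K) (hu : InClass S g u) :
    InClass S g (lipEnvelope K u) where
  cont := continuousOn_lipEnvelope K hu.cont
  bdd T := by
    obtain ⟨C, hC⟩ := hu.bdd T
    refine ⟨C + K * T, fun x hx t ht => ?_⟩
    obtain ⟨s, hs, h⟩ := exists_lipEnvelope_eq K hu.cont hx ht.1
    have h1 := abs_le.1 (hC x hx s ⟨hs.1, hs.2.trans ht.2⟩)
    have h2 : K * (t - s) ≤ K * T := mul_le_mul_of_nonneg_left (by linarith [hs.1, ht.2]) hK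
    have h3 : 0 ≤ K * (t - s) := mul_nonneg hK (by linarith [hs.2])
    rw [h, abs_le]
    constructor <;> linarith
  init x hx := by
    obtain ⟨s, hs, h⟩ := exists_lipEnvelope_eq K hu.cont hx le_rfl
    obtain rfl : s = 0 := le_antisymm hs.2 hs.1
    rw [h, hu.init x hx]
    simp

lemma lipEnvelope_sub_le (hu : ContinuousOn u (S ×ˢ Ici 0)) {x : Euc n} (hx : x ∈ S) {s t : ℝ}
    (hs : 0 ≤ s) (hst : s ≤ t) : lipEnvelope K u (x, s) - K * (t - s) ≤ lipEnvelope K u (x, t) := by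
  obtain ⟨r, hr, h⟩ := exists_lipEnvelope_eq K hu hx hs
  have := le_lipEnvelope K hu hx hr.1 (hr.2.trans hst)
  rw [h]
  linarith

end Envelope

variable {Ω : Set (Euc n)} {F : Euc n → Euc n → ℝ} {g : Euc n → ℝ} {u v : Euc n × ℝ → ℝ}

/-- For Lipschitz initial data and large `K`, the envelope of a subsolution is a subsolution. -/
lemma viscSub_lipEnvelope (hΩ : IsOpen Ω) (hu : InClass (closure Ω) g u)
    (hsub : ViscSub (Ω ×ˢ Ioi 0) (Ω ×ˢ Ioi 0) (evolOp F) u) {L : NNReal} (hg : LipschitzWith L g)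
    {K : ℝ} (hK : ∀ x p, ‖p‖ ≤ L → F x p ≤ K) :
    ViscSub (Ω ×ˢ Ioi 0) (Ω ×ˢ Ioi 0) (evolOp F) (lipEnvelope K u) := by
  intro z hz φ hφ hmax
  have hzc : z.1 ∈ closure Ω := subset_closure hz.1
  have hz2 : 0 < z.2 := hz.2
  obtain ⟨s, hs, h⟩ := exists_lipEnvelope_eq K hu.cont hzc hz2.le
  rcases hs.1.eq_or_lt with rfl | hs0
  -- The supremum is attained at time `0`: the envelope equals `g - K t` at `z` and lies above it
  -- elsewhere. A function touching from above has time slope at most `-K` and spatial gradient at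
  -- most `L`, so the choice of `K` gives the inequality.
  · have hm := IsLocalMaxOn.isLocalMax_of_prod hΩ hz hmax
    have hge : ∀ w ∈ Ω ×ˢ Ioi (0 : ℝ), g w.1 - K * w.2 ≤ lipEnvelope K u w := fun w hw => by
      have := le_lipEnvelope K hu.cont (subset_closure hw.1) le_rfl (le_of_lt hw.2)
      rwa [hu.init _ (subset_closure hw.1), sub_zero] at this
    have hev : ∀ᶠ w in 𝓝 z, φ z + (g w.1 - g z.1) - K * (w.2 - z.2) ≤ φ w := by
      filter_upwards [hm, (hΩ.prod isOpen_Ioi).mem_nhds hz] with w h1 h2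
      have h3 := hge w h2
      rw [hu.init _ hzc] at h
      rw [show lipEnvelope K u z = _ from h] at h1
      linarith
    have ht : 0 ≤ -deriv (fun s => φ (z.1, s)) z.2 - K := by
      refine deriv_nonneg_of_eventually_left (f := fun s => -φ (z.1, s) - K * s)
        (((hasDerivAt_time hφ z).neg.sub ((hasDerivAt_id z.2).const_mul K)).congr_deriv (by simp)) ?_
      have hc : Continuous fun s : ℝ => (z.1, s) := by fun_prop
      filter_upwards [((hc.tendsto z.2).mono_left nhdsWithin_le_nhds).eventually hev] with s hs
      linarith
    have hx : ‖gradient (fun x => φ (x, z.2)) z.1‖ ≤ L := by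
      refine norm_gradient_le_of_increment_ge L.2 (hasGradientAt_space hφ z) ?_
      have hc : Continuous fun x : Euc n => (x, z.2) := by fun_prop
      filter_upwards [(hc.tendsto z.1).eventually hev] with x hx
      have h1 := hg.dist_le_mul x z.1
      rw [dist_eq_norm, dist_eq_norm, Real.norm_eq_abs] at h1
      have h2 := (abs_le.1 h1).1
      simp only [sub_self, mul_zero, sub_zero] at hx
      linarith
    have := hK z.1 _ hx
    simp only [evolOp]
    linarith
  -- The supremum is attained at a positive time `s`: shifted in time by `d`, the test function
  -- touches `u` itself at `(z.1, s)`, up to a constant.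
  · set d := z.2 - s with hd
    have hsd : s + d = z.2 := by rw [hd]; ring
    have hmax' : IsLocalMaxOn (fun w => u w - φ (w.1, w.2 + d)) (Ω ×ˢ Ioi 0) (z.1, s) := by
      have h2 := tendsto_timeShift (Ω := Ω) (x := z.1) (by rwa [hsd] : 0 < s + d)
      rw [hsd] at h2
      filter_upwards [h2.eventually hmax, self_mem_nhdsWithin] with w hw hwΩ
      have h3 := le_lipEnvelope K hu.cont (subset_closure hwΩ.1) (le_of_lt hwΩ.2)
        (show w.2 ≤ w.2 + d by linarith [hs.2])
      simp only [Prod.mk.eta, hsd] at h3 hw ⊢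
      rw [show lipEnvelope K u z = _ from h] at hw
      linarith
    have h1 := hsub (z.1, s) ⟨hz.1, hs0⟩ (fun w => φ (w.1, w.2 + d)) (hφ.comp (by fun_prop)) hmax'
    simpa only [evolOp, deriv_comp_add_const (fun s => φ (z.1, s)), hsd] using h1

/-! ### The comparison principle -/

/-- Comparison principle for the state-constraint problem with Lipschitz initial data. -/
theorem comparison (hΩ : IsOpen Ω) (hcone : HasInwardCone Ω) (hF : AdmissibleHamiltonian F)
    (hg : ∃ L, LipschitzWith L g) (hu : InClass (closure Ω) g u) (hv : InClass (closure Ω) g v)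
    (hsub : ViscSub (Ω ×ˢ Ioi 0) (Ω ×ˢ Ioi 0) (evolOp F) u)
    (hsuper : ViscSuper (closure Ω ×ˢ Ioi 0) (closure Ω ×ˢ Ioi 0) (evolOp F) v)
    {x : Euc n} (hx : x ∈ closure Ω) {t : ℝ} (ht : 0 ≤ t) : u (x, t) ≤ v (x, t) := by
  obtain ⟨L, hL⟩ := hg
  obtain ⟨K₀, hK₀⟩ := hF.bdd L
  set K := max K₀ 0
  have hsub' := viscSub_lipEnvelope hΩ hu hsub hL (K := K)
    fun x p hp => (hK₀ x p hp).trans (le_max_left _ _)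
  have hsubK : ViscSub (Ω ×ˢ Ioi 0) (Ω ×ˢ Ioi 0) (fun z _ _ p => F z.1 p - K)
      (lipEnvelope K u) := by
    intro z hz φ hφ hmax
    have h1 := hsub' z hz φ hφ hmax
    -- The envelope decreases at most with speed `K`, so `φ_t ≥ -K`; the subsolution inequality then
    -- bounds the Hamiltonian by `K`.
    have h2 : 0 ≤ deriv (fun s => φ (z.1, s)) z.2 + K := by
      refine deriv_nonneg_of_eventually_right (f := fun s => φ (z.1, s) + K * s)
        (((hasDerivAt_time hφ z).add ((hasDerivAt_id z.2).const_mul K)).congr_deriv (by simp)) ?_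
      have hc : Continuous fun s : ℝ => (z.1, s) := by fun_prop
      filter_upwards [((hc.tendsto z.2).mono_left nhdsWithin_le_nhds).eventually
        (IsLocalMaxOn.isLocalMax_of_prod hΩ hz hmax), self_mem_nhdsWithin] with s hs hzs
      have h3 := lipEnvelope_sub_le K hu.cont (subset_closure hz.1) (le_of_lt hz.2) (le_of_lt hzs)
      simp only [Prod.mk.eta] at hs h3 ⊢
      linarith
    simp only [evolOp] at h1 ⊢
    linarith
  have h1 := comparison_of_bounded hcone hF (inClass_lipEnvelope K (le_max_right _ _) hu) hv hsub'
    hsubK hsuper hx ht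
  have h2 := le_lipEnvelope K hu.cont hx ht le_rfl
  linarith

end Comparison

/-! ### Inward cones of perforated domains -/

section DomainAndHamiltonian

variable {n : ℕ}

lemma hasInwardCone_univ : HasInwardCone (univ : Set (Euc n)) :=
  fun _ _ => ⟨0, 1, one_pos, fun _ _ _ _ _ _ _ _ => trivial⟩

/-- At a boundary point the graph direction works: for `x = y + δ ν + w` the height grows by at
least `δ - ‖w‖`, while the graph rises by at most `2 L ‖w‖` because `w` alone moves the projection.
At interior points `ν = 0` suffices. -/
lemma hasInwardCone_of_hasC1Boundary {Ω : Set (Euc n)} (hΩ : IsOpen Ω) (h : HasC1Boundary Ω) :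
    HasInwardCone Ω := by
  intro x₀ hx₀
  by_cases hx : x₀ ∈ Ω
  · obtain ⟨r, hr, hball⟩ := Metric.isOpen_iff.1 hΩ x₀ hx
    refine ⟨0, min 1 (r / 2), by positivity, fun y _ hy δ hδ hδκ x hxy => hball ?_⟩
    rw [smul_zero, sub_zero, ← dist_eq_norm] at hxy
    have h1 : min 1 (r / 2) * δ ≤ r / 2 := by
      have h2 : δ ≤ 1 := hδκ.le.trans (min_le_left _ _)
      calc min 1 (r / 2) * δ ≤ r / 2 * 1 := by gcongr; exact min_le_right _ _
        _ = r / 2 := mul_one _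
    have h2 : dist y x₀ < r / 2 := hy.trans_le (min_le_right _ _)
    exact (dist_triangle x y x₀).trans_lt (by linarith)
  · have hfr : x₀ ∈ frontier Ω := ⟨hx₀, by rwa [hΩ.interior_eq]⟩
    obtain ⟨ν, γ, r, hν, hγ, hr, hgraph⟩ := h x₀ hfr
    set π : Euc n → Euc n := fun x => x - inner ℝ ν x • ν with hπ
    have hπc : Continuous π := by fun_prop
    have hπn : ∀ x, ‖π x‖ ≤ 2 * ‖x‖ := fun x => by
      have h1 := norm_inner_le_norm (𝕜 := ℝ) ν x
      have h2 := norm_sub_le x (inner ℝ ν x • ν)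
      rw [norm_smul, hν, mul_one] at h2
      rw [hν, one_mul] at h1
      linarith
    have hπsub : ∀ x y, π x - π y = π (x - y) := fun x y => by
      simp only [hπ, inner_sub_right, sub_smul]; abel
    have hνν : inner ℝ ν ν = 1 := by rw [real_inner_self_eq_norm_sq, hν, one_pow]
    obtain ⟨L, s, hs, hL⟩ := (hγ.contDiffAt (x := π x₀)).exists_lipschitzOnWith
    obtain ⟨r₂, hr₂, hball⟩ := Metric.mem_nhds_iff.1 hs
    have hcl : ∀ y ∈ closure Ω, y ∈ Metric.ball x₀ r → γ (π y) ≤ inner ℝ ν y := by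
      intro y hy hyb
      have h1 : y ∈ closure (Metric.ball x₀ r ∩ Ω) :=
        Metric.isOpen_ball.inter_closure ⟨hyb, hy⟩
      have h2 : IsClosed {y | γ (π y) ≤ inner ℝ ν y} :=
        isClosed_le (hγ.continuous.comp hπc) (by fun_prop)
      exact closure_minimal (fun z hz => ((hgraph z hz.1).1 hz.2).le) h2 h1
    have hL0 : (0 : ℝ) ≤ L := L.2
    -- The first bound makes the gain in height win. The others keep `x` and `y`, at distance below
    -- `3 * κ` from `x₀`, in the graph ball and their projections in the Lipschitz neighbourhood, as
    -- `π` at most doubles norms.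
    set κ := min (1 / (1 + 2 * (L : ℝ))) (min (r / 3) (r₂ / 6)) with hκ
    have hκ0 : 0 < κ := by positivity
    have hκL : κ * (1 + 2 * L) ≤ 1 := by
      rw [← le_div_iff₀ (by positivity)]; exact min_le_left _ _
    have hκ1 : κ ≤ 1 := by nlinarith
    have hκr : 3 * κ ≤ r := by
      have : κ ≤ r / 3 := (min_le_right _ _).trans (min_le_left _ _)
      linarith
    have hκr₂ : 6 * κ ≤ r₂ := by
      have : κ ≤ r₂ / 6 := (min_le_right _ _).trans (min_le_right _ _)
      linarith
    refine ⟨ν, κ, hκ0, fun y hy hyx δ hδ hδκ x hxy => ?_⟩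
    set w := x - y - δ • ν with hw
    have hxyw : x - y = δ • ν + w := by rw [hw]; abel
    have hxyn : ‖x - y‖ ≤ 2 * κ := by
      rw [hxyw]
      refine (norm_add_le _ _).trans ?_
      rw [norm_smul, hν, mul_one, Real.norm_of_nonneg hδ.le]
      nlinarith
    have hxx : dist x x₀ < 3 * κ := by
      have := dist_triangle x y x₀
      rw [dist_eq_norm x y] at this
      linarith
    have hmem : ∀ z, dist z x₀ < 3 * κ → π z ∈ s := fun z hz => hball <| by
      rw [Metric.mem_ball, dist_eq_norm, hπsub]
      rw [dist_eq_norm] at hz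
      linarith [hπn (z - x₀)]
    have hπxy : ‖π x - π y‖ ≤ 2 * ‖w‖ := by
      have h1 : π x - π y = π w := by
        rw [hπsub, hxyw]
        simp only [hπ, inner_add_right, inner_smul_right, hνν, add_smul]
        rw [mul_one]
        abel
      rw [h1]
      exact hπn w
    have h1 := hL.dist_le_mul (π x) (hmem x hxx) (π y) (hmem y (by linarith))
    rw [Real.dist_eq, dist_eq_norm] at h1
    have h2 := (abs_le.1 h1).2
    have h3 := hcl y hy (by rw [Metric.mem_ball]; linarith)
    have h4 : inner ℝ ν x = inner ℝ ν y + δ + inner ℝ ν w := by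
      have : x = y + (δ • ν + w) := by rw [← hxyw]; abel
      rw [this]
      simp only [inner_add_right, inner_smul_right, hνν]
      ring
    have h5 : -‖w‖ ≤ inner ℝ ν w := by
      have := norm_inner_le_norm (𝕜 := ℝ) ν w
      rw [hν, one_mul, Real.norm_eq_abs] at this
      exact (abs_le.1 this).1
    refine (hgraph x (by rw [Metric.mem_ball]; linarith)).2 ?_
    change γ (π x) < _
    have h6 : (L : ℝ) * ‖π x - π y‖ ≤ L * (2 * ‖w‖) := mul_le_mul_of_nonneg_left hπxy hL0
    have h7 : ‖w‖ * (1 + 2 * L) < κ * δ * (1 + 2 * L) :=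
      mul_lt_mul_of_pos_right hxy (by positivity)
    have h8 : κ * δ * (1 + 2 * L) ≤ δ := by nlinarith
    linarith

lemma HasInwardCone.smul {Ω : Set (Euc n)} (h : HasInwardCone Ω) {ε : ℝ} (hε : 0 < ε) :
    HasInwardCone (ε • Ω) := by
  have hmem : ∀ x, ε⁻¹ • x ∈ Ω ↔ x ∈ ε • Ω := fun x => (mem_smul_set_iff_inv_smul_mem₀ hε.ne' Ω x).symm
  have hmemc : ∀ x, x ∈ closure (ε • Ω) → ε⁻¹ • x ∈ closure Ω := fun x hx => by
    rwa [closure_smul₀, mem_smul_set_iff_inv_smul_mem₀ hε.ne'] at hx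
  intro x₀ hx₀
  obtain ⟨ν, κ, hκ, hν⟩ := h _ (hmemc x₀ hx₀)
  have hnorm : ∀ z : Euc n, ‖ε⁻¹ • z‖ = ε⁻¹ * ‖z‖ := fun z => by
    rw [norm_smul, norm_inv, Real.norm_of_nonneg hε.le]
  have hscale : ∀ {a : ℝ}, a < min κ (ε * κ) → ε⁻¹ * a < κ := fun {a} ha => by
    rw [inv_mul_lt_iff₀ hε]; exact ha.trans_le (min_le_right _ _)
  refine ⟨ν, min κ (ε * κ), by positivity, fun y hy hyx δ hδ hδκ x hx => (hmem x).1 ?_⟩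
  refine hν _ (hmemc y hy) ?_ (ε⁻¹ * δ) (by positivity) (hscale hδκ) _ ?_
  · rw [dist_eq_norm, ← smul_sub, hnorm, ← dist_eq_norm]
    exact hscale hyx
  · rw [mul_smul, ← smul_sub, ← smul_sub, hnorm]
    calc ε⁻¹ * ‖x - y - δ • ν‖ < ε⁻¹ * (min κ (ε * κ) * δ) := by gcongr
      _ ≤ ε⁻¹ * (κ * δ) := by gcongr; exact min_le_left _ _
      _ = κ * (ε⁻¹ * δ) := by ring

/-! ### Bounds and moduli from periodicity and coercivity -/

section Hamiltonian

variable {H : Euc n → Euc n → ℝ}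

lemma exists_norm_add_latticeVec_le (y : Euc n) :
    ∃ k : Fin n → ℤ, ‖y + latticeVec k‖ ≤ √n := by
  refine ⟨fun i => -⌊y i⌋, ?_⟩
  rw [EuclideanSpace.norm_eq]
  refine Real.sqrt_le_sqrt ?_
  calc ∑ i, ‖(y + latticeVec fun i => -⌊y i⌋) i‖ ^ 2 ≤ ∑ _i : Fin n, (1 : ℝ) := by
        refine Finset.sum_le_sum fun i _ => ?_
        have h : (y + latticeVec fun i => -⌊y i⌋) i = Int.fract (y i) := by
          simp [latticeVec, Int.fract, sub_eq_add_neg]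
        rw [h, Real.norm_of_nonneg (Int.fract_nonneg _)]
        exact pow_le_one₀ (Int.fract_nonneg _) (Int.fract_lt_one _).le
    _ = n := by simp

lemma A1.exists_le (h1 : A1 H) (R : ℝ) : ∃ C, ∀ y p, ‖p‖ ≤ R → H y p ≤ C := by
  obtain ⟨C, hC⟩ := (((isCompact_closedBall (0 : Euc n) √n).prod
    (isCompact_closedBall (0 : Euc n) R)).image h1.1).bddAbove
  refine ⟨C, fun y p hp => ?_⟩
  obtain ⟨k, hk⟩ := exists_norm_add_latticeVec_le y
  rw [← h1.2 p y k]
  exact hC ⟨(y + latticeVec k, p), ⟨by simpa using hk, by simpa using hp⟩, rfl⟩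

lemma A2.exists_norm_le (h2 : A2 H) (h7 : A7 H) (K : ℝ) : ∃ R, ∀ y p, H y p ≤ K → ‖p‖ ≤ R := by
  obtain ⟨R, -, hR⟩ := (Metric.hasBasis_cobounded_compl_closedBall (0 : Euc n)).eventually_iff.1
    (h2.eventually_gt_atTop K)
  refine ⟨R, fun y p hp => ?_⟩
  by_contra! hlt
  have h1 : K < ⨅ y, H y p := hR (by simpa using hlt)
  -- Nonnegativity makes the family bounded below, so the real `⨅` is a genuine infimum rather than
  -- a default value.
  have h3 : ⨅ y, H y p ≤ H y p := ciInf_le ⟨0, by rintro _ ⟨y, rfl⟩; exact (h7 y).2 p⟩ y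
  linarith

/-- On a sublevel set coercivity confines `ξ` to a ball, so uniform continuity on a compact set
applies. The allowance `2 * ρ` in the gradient absorbs the derivative of a localizing term `‖y - y₀‖
^ 2`. -/
lemma exists_modulus (h1 : A1 H) (h2 : A2 H) (h7 : A7 H) (K : ℝ) (y₀ : Euc n) {η : ℝ}
    (hη : 0 < η) : ∃ ρ > 0, ∀ x y ξ ξ', dist x y₀ < ρ → dist y y₀ < ρ → ‖ξ' - ξ‖ ≤ 2 * ρ →
      H x ξ ≤ K → H y ξ' ≤ H x ξ + η := by
  obtain ⟨R, hR⟩ := h2.exists_norm_le h7 K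
  have hu := ((isCompact_closedBall y₀ 1).prod
    (isCompact_closedBall (0 : Euc n) (R + 2))).uniformContinuousOn_of_continuous h1.1.continuousOn
  obtain ⟨d, hd, hu⟩ := Metric.uniformContinuousOn_iff.1 hu η hη
  refine ⟨min 1 (d / 3), by positivity, fun x y ξ ξ' hx hy hξ hK => ?_⟩
  have hξR := hR x ξ hK
  have hρ1 : min 1 (d / 3) ≤ 1 := min_le_left _ _
  have hρd : min 1 (d / 3) ≤ d / 3 := min_le_right _ _
  have hξ' : ‖ξ'‖ ≤ R + 2 := by
    have : ‖ξ'‖ ≤ ‖ξ‖ + ‖ξ' - ξ‖ := norm_le_norm_add_norm_sub' ξ' ξ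
    linarith
  have h := hu (y, ξ') ⟨Metric.mem_closedBall.2 (hy.le.trans hρ1), by simpa using hξ'⟩ (x, ξ)
    ⟨Metric.mem_closedBall.2 (hx.le.trans hρ1),
      by simpa using hξR.trans (le_add_of_nonneg_right zero_le_two)⟩ (by
    refine max_lt ?_ ?_
    · have := dist_triangle_right y x y₀
      simp only
      linarith
    · simp only [dist_eq_norm]
      linarith)
  rw [Real.dist_eq] at h
  linarith [(abs_lt.1 h).2]

lemma admissibleHamiltonian_scaled (h1 : A1 H) (h2 : A2 H) (h3 : A3 H) (h7 : A7 H) {ε : ℝ}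
    (hε : 0 < ε) : AdmissibleHamiltonian fun x p => H (ε⁻¹ • x) p where
  convex x := h3 _
  bdd R := by
    obtain ⟨C, hC⟩ := h1.exists_le R
    exact ⟨C, fun x p hp => hC _ p hp⟩
  modulus K x₀ η hη := by
    obtain ⟨ρ, hρ, h⟩ := exists_modulus h1 h2 h7 K (ε⁻¹ • x₀) hη
    have hs : ∀ x, dist x x₀ < ε * ρ → dist (ε⁻¹ • x) (ε⁻¹ • x₀) < ρ := fun x hx => by
      rw [dist_smul₀, norm_inv, Real.norm_of_nonneg hε.le, inv_mul_lt_iff₀ hε]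
      exact hx
    exact ⟨ε * ρ, by positivity, fun x y hx hy p hp =>
      h _ _ p p (hs x hx) (hs y hy) (by simpa using hρ.le) hp⟩

end Hamiltonian

end DomainAndHamiltonian

/-! ### The cell problem and properties of the effective Hamiltonian -/

section CellProblem

variable {n : ℕ} {Ω : Set (Euc n)} {H : Euc n → Euc n → ℝ}

lemma add_latticeVec_mem_closure (hper : ∀ (k : Fin n → ℤ) (y : Euc n), y + latticeVec k ∈ Ω ↔ y ∈ Ω)
    {y : Euc n} (hy : y ∈ closure Ω) (k : Fin n → ℤ) : y + latticeVec k ∈ closure Ω :=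
  map_mem_closure (f := fun y => y + latticeVec k) (by fun_prop) hy fun y hy => (hper k y).2 hy

/-- A continuous periodic function on `closure Ω` attains its maximum. -/
lemma exists_max_of_periodic (hΩ : IsPerforatedDomain Ω) {f : Euc n → ℝ}
    (hf : ContinuousOn f (closure Ω))
    (hper : ∀ y ∈ closure Ω, ∀ k : Fin n → ℤ, f (y + latticeVec k) = f y) :
    ∃ y₀ ∈ closure Ω, ∀ y ∈ closure Ω, f y ≤ f y₀ := by
  have hc : IsCompact (closure Ω ∩ Metric.closedBall 0 √n) :=
    (isCompact_closedBall _ _).inter_left isClosed_closure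
  have hshift : ∀ y ∈ closure Ω, ∃ k : Fin n → ℤ,
      y + latticeVec k ∈ closure Ω ∩ Metric.closedBall 0 √n := fun y hy => by
    obtain ⟨k, hk⟩ := exists_norm_add_latticeVec_le y
    exact ⟨k, add_latticeVec_mem_closure hΩ.periodic hy k, by simpa using hk⟩
  obtain ⟨y, hy⟩ := hΩ.isConnected.nonempty
  obtain ⟨k, hk⟩ := hshift y (subset_closure hy)
  obtain ⟨y₀, hy₀, hmax⟩ := hc.exists_isMaxOn ⟨_, hk⟩ (hf.mono inter_subset_left)
  refine ⟨y₀, hy₀.1, fun y hy => ?_⟩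
  obtain ⟨k, hk⟩ := hshift y hy
  rw [← hper y hy k]
  exact hmax hk

namespace IsCellSolution

variable {p : Euc n} {c : ℝ} {v : Euc n → ℝ}

/-- At a minimum point of the periodic function `v`, possibly on the boundary, a constant is an
admissible test function. This bounds the effective Hamiltonian locally. -/
lemma exists_le (hΩ : IsPerforatedDomain Ω) (h : IsCellSolution H Ω p c v) : ∃ y, c ≤ H y p := by
  obtain ⟨y₀, hy₀, hmax⟩ := exists_max_of_periodic hΩ h.cont.neg fun y hy k => by
    simp only [Pi.neg_apply, h.periodic y hy k]
  refine ⟨y₀, ?_⟩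
  have h1 := h.super y₀ hy₀ (fun _ => 0) contDiff_const <| by
    filter_upwards [self_mem_nhdsWithin] with y hy
    simpa using hmax y hy
  simpa [gradient_const] using h1

/-- A steep paraboloid touches `v` from above at some interior point, and there `0 ≤ H ≤ c`. -/
lemma nonneg (hΩ : IsPerforatedDomain Ω) (h7 : A7 H) (h : IsCellSolution H Ω p c v) : 0 ≤ c := by
  obtain ⟨y₀, hy₀⟩ := hΩ.isConnected.nonempty
  obtain ⟨r, hr, hball⟩ := Metric.nhds_basis_closedBall.mem_iff.1 (hΩ.isOpen.mem_nhds hy₀)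
  have hv : ContinuousOn v (Metric.closedBall y₀ r) := h.cont.mono (hball.trans subset_closure)
  obtain ⟨B, hB⟩ := (isCompact_closedBall y₀ r).exists_bound_of_continuousOn hv
  have hB0 : 0 ≤ B := (norm_nonneg _).trans (hB y₀ (Metric.mem_closedBall_self hr.le))
  -- On the sphere of radius `r` the paraboloid has height `2 * B + 1`, more than `v` can oscillate,
  -- so the maximum is inside.
  set M := (2 * B + 1) / r ^ 2 with hM
  have hMr : M * r ^ 2 = 2 * B + 1 := by rw [hM]; field_simp
  have hψ : ContDiff ℝ 1 fun y : Euc n => M * ‖y - y₀‖ ^ 2 :=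
    contDiff_const.mul ((contDiff_id.sub contDiff_const).norm_sq ℝ)
  obtain ⟨y, hy, hmax⟩ := (isCompact_closedBall y₀ r).exists_isMaxOn
    ⟨y₀, Metric.mem_closedBall_self hr.le⟩ (hv.sub hψ.continuous.continuousOn)
  have hyr : dist y y₀ < r := by
    refine lt_of_le_of_ne hy fun heq => ?_
    have h1 := hmax (Metric.mem_closedBall_self hr.le)
    simp only [mem_ofPred_eq, Pi.sub_apply, ← dist_eq_norm, heq, dist_self, hMr] at h1
    have h2 := (abs_le.1 (hB y hy)).2
    have h3 := (abs_le.1 (hB y₀ (Metric.mem_closedBall_self hr.le))).1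
    nlinarith
  refine ((h7 y).2 _).trans (h.sub y (hball hy) _ hψ ?_)
  filter_upwards [eventually_mem_closedBall_of_dist_lt hyr Ω] with z hz
  exact hmax hz

/-- The solvability constant of the cell problem is convex in `p`. -/
lemma convex_combination (hΩ : IsPerforatedDomain Ω) (h1 : A1 H) (h2 : A2 H) (h3 : A3 H)
    (h7 : A7 H) {p₁ p₂ : Euc n} {c₁ c₂ a₁ a₂ : ℝ} {v₁ v₂ : Euc n → ℝ}
    (hv₁ : IsCellSolution H Ω p₁ c₁ v₁) (hv₂ : IsCellSolution H Ω p₂ c₂ v₂)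
    (ha₁ : 0 < a₁) (ha₂ : 0 < a₂) (ha : a₁ + a₂ = 1)
    (hv : IsCellSolution H Ω (a₁ • p₁ + a₂ • p₂) c v) : c ≤ a₁ * c₁ + a₂ * c₂ := by
  refine le_of_forall_pos_le_add fun η hη => ?_
  obtain ⟨y₀, hy₀, hmax⟩ := exists_max_of_periodic hΩ
    (((hv₁.cont.const_smul a₁).add (hv₂.cont.const_smul a₂)).sub hv.cont) fun y hy k => by
    simp only [Pi.sub_apply, Pi.add_apply, Pi.smul_apply, hv₁.periodic y hy k,
      hv₂.periodic y hy k, hv.periodic y hy k]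
  simp only [Pi.sub_apply, Pi.add_apply, Pi.smul_apply, smul_eq_mul] at hmax
  obtain ⟨ν, κ, hκ, hν⟩ := hasInwardCone_of_hasC1Boundary hΩ.isOpen hΩ.c1Boundary y₀ hy₀
  obtain ⟨ρ₁, hρ₁, hmod₁⟩ := exists_modulus h1 h2 h7 c₁ y₀ hη
  obtain ⟨ρ₂, hρ₂, hmod₂⟩ := exists_modulus h1 h2 h7 c₂ y₀ hη
  set A : Set (Euc n) := closure Ω ∩ Metric.closedBall y₀ 1 with hA
  have hAc : IsCompact A := (isCompact_closedBall y₀ 1).inter_left isClosed_closure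
  have hy₀A : y₀ ∈ A := ⟨hy₀, Metric.mem_closedBall_self zero_le_one⟩
  have hν' : ∀ᶠ δ in 𝓝[>] (0 : ℝ), (y₀, y₀) + δ • (ν, ν) ∈ A ×ˢ A := by
    have h1 : Tendsto (fun δ : ℝ => y₀ + δ • ν) (𝓝[>] 0) (𝓝 y₀) := by
      have : Continuous fun δ : ℝ => y₀ + δ • ν := by fun_prop
      simpa using (this.tendsto 0).mono_left nhdsWithin_le_nhds
    filter_upwards [h1.eventually (Metric.closedBall_mem_nhds y₀ one_pos),
      HasInwardCone.eventually_mem hκ hy₀ hν] with δ h2 h3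
    have : y₀ + δ • ν ∈ A := ⟨subset_closure h3, h2⟩
    exact ⟨this, this⟩
  -- Each subsolution gets its own variable, and both are tied to the supersolution's variable by
  -- the diagonal `ι`. The term `‖y - y₀‖ ^ 2` makes the maximum strict.
  obtain ⟨δ, hδ0, hδ, ⟨x₁, x₂⟩, ⟨hx₁A, hx₂A⟩, y, hyA, hy0, hx0, hxy, hM⟩ :=
    exists_isMaxOn_penalized (f := fun x : Euc n × Euc n => a₁ * v₁ x.1 + a₂ * v₂ x.2)
      (h := fun y => v y + ‖y - y₀‖ ^ 2) (ι := fun y => (y, y))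
      (N := fun w : Euc n × Euc n => ‖w.1‖ ^ 2 + ‖w.2‖ ^ 2) (ν := (ν, ν)) (y₀ := y₀)
      (hAc.prod hAc) hAc
      ((continuousOn_const.mul (hv₁.cont.comp continuousOn_fst fun x hx => hx.1.1)).add
        (continuousOn_const.mul (hv₂.cont.comp continuousOn_snd fun x hx => hx.2.1)))
      ((hv.cont.mono inter_subset_left).add (by fun_prop)) (by fun_prop) (by fun_prop) (by simp)
      (fun w => by
        rcases max_cases ‖w.1‖ ‖w.2‖ with h | h <;> rw [Prod.norm_def, h.1] <;>
          nlinarith [sq_nonneg ‖w.1‖, sq_nonneg ‖w.2‖])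
      hy₀A ⟨hy₀A, hy₀A⟩ (fun y hy _ h => by
        have h1 := hmax y hy.1
        simp only [sub_self, norm_zero] at h
        have h2 : ‖y - y₀‖ ^ 2 = 0 := le_antisymm (by linarith) (sq_nonneg _)
        simpa [sub_eq_zero] using h2) hν'
      (ρ := min (min ρ₁ ρ₂) (min κ 1)) (by positivity)
  set ρ := min (min ρ₁ ρ₂) (min κ 1) with hρ
  have hρρ₁ : ρ ≤ ρ₁ := (min_le_left _ _).trans (min_le_left _ _)
  have hρρ₂ : ρ ≤ ρ₂ := (min_le_left _ _).trans (min_le_right _ _)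
  have hρκ : ρ ≤ κ := (min_le_right _ _).trans (min_le_left _ _)
  have hρ1 : ρ ≤ 1 := (min_le_right _ _).trans (min_le_right _ _)
  have hx₁0 : dist x₁ y₀ < ρ := (le_max_left _ _).trans_lt hx0
  have hx₂0 : dist x₂ y₀ < ρ := (le_max_right _ _).trans_lt hx0
  have hmem : ∀ x, ‖x - y - δ • ν‖ ≤ ‖(x₁, x₂) - (y, y) - δ • (ν, ν)‖ → x ∈ Ω := fun x hx =>
    hν y hyA.1 (hy0.trans_le hρκ) δ hδ0 (hδ.trans_le hρκ) x
      (hx.trans_lt (hxy.trans_le (mul_le_mul_of_nonneg_right hρκ hδ0.le)))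
  have hx₁Ω : x₁ ∈ Ω := hmem x₁ (norm_fst_le ((x₁, x₂) - (y, y) - δ • (ν, ν)))
  have hx₂Ω : x₂ ∈ Ω := hmem x₂ (norm_snd_le ((x₁, x₂) - (y, y) - δ • (ν, ν)))
  simp only [Prod.mk_sub_mk, Prod.smul_mk, Prod.forall] at hM
  -- a subsolution tested with its share of the penalization
  have hsubtest : ∀ {a b : ℝ} {q x : Euc n} {w : Euc n → ℝ}, 0 < a → IsCellSolution H Ω q b w →
      x ∈ Ω → dist x y₀ < ρ → (∀ x' ∈ A, a * w x' - ‖δ⁻¹ • (x' - y) - ν‖ ^ 2 ≤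
        a * w x - ‖δ⁻¹ • (x - y) - ν‖ ^ 2) →
      H x (q + a⁻¹ • (2 * δ⁻¹) • (δ⁻¹ • (x - y) - ν)) ≤ b := by
    intro a b q x w ha hw hxΩ hx hle
    have hgrad : HasGradientAt (fun x => a⁻¹ * ‖δ⁻¹ • (x - y) - ν‖ ^ 2)
        (a⁻¹ • (2 * δ⁻¹) • (δ⁻¹ • (x - y) - ν)) x := by
      rw [hasGradientAt_iff_hasFDerivAt]
      exact ((hasGradientAt_penalty δ⁻¹ y ν x).hasFDerivAt.const_mul a⁻¹).congr_fderiv (by simp)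
    rw [← hgrad.gradient]
    refine hw.sub x hxΩ _ (contDiff_const.mul (ContDiff.norm_sq ℝ (by fun_prop))) ?_
    filter_upwards [eventually_mem_closedBall_of_dist_lt (hx.trans_le hρ1) Ω,
      self_mem_nhdsWithin] with x' hx' hx'Ω
    have h := hle x' ⟨subset_closure hx'Ω, hx'⟩
    have h' : ∀ z, a * (w z - a⁻¹ * ‖δ⁻¹ • (z - y) - ν‖ ^ 2) =
        a * w z - ‖δ⁻¹ • (z - y) - ν‖ ^ 2 := fun z => by field_simp
    refine le_of_mul_le_mul_left ?_ ha
    rw [h', h']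
    exact h
  have hs₁ := hsubtest ha₁ hv₁ hx₁Ω hx₁0 fun x' hx' => by
    linarith [hM x' x₂ ⟨hx', hx₂A⟩ y hyA]
  have hs₂ := hsubtest ha₂ hv₂ hx₂Ω hx₂0 fun x' hx' => by
    linarith [hM x₁ x' ⟨hx₁A, hx'⟩ y hyA]
  set q₁ := (2 * δ⁻¹) • (δ⁻¹ • (x₁ - y) - ν) with hq₁
  set q₂ := (2 * δ⁻¹) • (δ⁻¹ • (x₂ - y) - ν) with hq₂
  set e := (2 : ℝ) • (y - y₀) with he
  have hgrad : HasGradientAt (fun y => -‖δ⁻¹ • (x₁ - y) - ν‖ ^ 2 +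
      -‖δ⁻¹ • (x₂ - y) - ν‖ ^ 2 - ‖y - y₀‖ ^ 2) (q₁ + q₂ - e) y := by
    have h0 := hasGradientAt_penalty 1 y₀ 0 y
    simp only [one_smul, sub_zero, mul_one] at h0
    rw [hasGradientAt_iff_hasFDerivAt, map_sub, map_add]
    exact ((hasGradientAt_penalty_right δ⁻¹ x₁ ν y).hasFDerivAt.add
      (hasGradientAt_penalty_right δ⁻¹ x₂ ν y).hasFDerivAt).sub h0.hasFDerivAt
  have hs := hv.super y hyA.1 (fun y => -‖δ⁻¹ • (x₁ - y) - ν‖ ^ 2 +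
      -‖δ⁻¹ • (x₂ - y) - ν‖ ^ 2 - ‖y - y₀‖ ^ 2) (by
    refine ((ContDiff.neg (ContDiff.norm_sq ℝ ?_)).add
      (ContDiff.neg (ContDiff.norm_sq ℝ ?_))).sub (ContDiff.norm_sq ℝ ?_) <;> fun_prop) (by
    filter_upwards [eventually_mem_closedBall_of_dist_lt (hy0.trans_le hρ1) (closure Ω),
      self_mem_nhdsWithin] with y' hy' hy'Ω
    linarith [hM x₁ x₂ ⟨hx₁A, hx₂A⟩ y' ⟨hy'Ω, hy'⟩])
  rw [hgrad.gradient] at hs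
  have hen : ‖e‖ ≤ 2 * ρ := by
    rw [he, norm_smul, ← dist_eq_norm, Real.norm_of_nonneg zero_le_two]
    linarith
  have hm₁ := hmod₁ x₁ y (p₁ + a₁⁻¹ • q₁) (p₁ + a₁⁻¹ • q₁ - e) (hx₁0.trans_le hρρ₁)
    (hy0.trans_le hρρ₁) (by rw [sub_sub_cancel_left, norm_neg]; linarith) hs₁
  have hm₂ := hmod₂ x₂ y (p₂ + a₂⁻¹ • q₂) (p₂ + a₂⁻¹ • q₂ - e) (hx₂0.trans_le hρρ₂)
    (hy0.trans_le hρρ₂) (by rw [sub_sub_cancel_left, norm_neg]; linarith) hs₂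
  have hcv := (h3 y).2 (mem_univ (p₁ + a₁⁻¹ • q₁ - e)) (mem_univ (p₂ + a₂⁻¹ • q₂ - e)) ha₁.le
    ha₂.le ha
  have heq : a₁ • (p₁ + a₁⁻¹ • q₁ - e) + a₂ • (p₂ + a₂⁻¹ • q₂ - e) =
      a₁ • p₁ + a₂ • p₂ + (q₁ + q₂ - e) := by
    -- As the weights sum to one, the gradient `e` of the localizing term can be subtracted from
    -- both momenta, where the modulus absorbs it.
    have h1 : e = a₁ • e + a₂ • e := by rw [← add_smul, ha, one_smul]
    conv_rhs => rw [h1]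
    simp only [smul_add, smul_sub, smul_smul, mul_inv_cancel₀ ha₁.ne', mul_inv_cancel₀ ha₂.ne',
      one_smul]
    abel
  rw [heq, smul_eq_mul, smul_eq_mul] at hcv
  have h4 := mul_le_mul_of_nonneg_left (hm₁.trans (add_le_add_left hs₁ η)) ha₁.le
  have h5 := mul_le_mul_of_nonneg_left (hm₂.trans (add_le_add_left hs₂ η)) ha₂.le
  have h6 : a₁ * η + a₂ * η = η := by rw [← add_mul, ha, one_mul]
  linarith

end IsCellSolution

lemma effectiveHamiltonian_spec (h : ∃ G, IsEffectiveHamiltonian H Ω G) :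
    IsEffectiveHamiltonian H Ω (effectiveHamiltonian H Ω) := by
  rw [effectiveHamiltonian, dif_pos h]
  exact h.choose_spec

lemma effectiveHamiltonian_nonneg (hΩ : IsPerforatedDomain Ω) (h7 : A7 H) (p : Euc n) :
    0 ≤ effectiveHamiltonian H Ω p := by
  by_cases h : ∃ G, IsEffectiveHamiltonian H Ω G
  · obtain ⟨v, hv⟩ := effectiveHamiltonian_spec h p
    exact hv.nonneg hΩ h7
  · rw [effectiveHamiltonian, dif_neg h, Pi.zero_apply]

/-- There is no dependence on `x`, so only convexity and local boundedness matter, and any choice of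
solvable constants has both. If the cell problem is not solvable for every `p`, the default `0` is
admissible as well. -/
lemma admissibleHamiltonian_effective (hΩ : IsPerforatedDomain Ω) (h1 : A1 H) (h2 : A2 H)
    (h3 : A3 H) (h7 : A7 H) :
    AdmissibleHamiltonian fun _ : Euc n => effectiveHamiltonian H Ω := by
  by_cases h : ∃ G, IsEffectiveHamiltonian H Ω G
  · have hG := effectiveHamiltonian_spec h
    refine ⟨fun _ => ?_, fun R => ?_, fun K x₀ η hη => ⟨1, one_pos, fun _ _ _ _ p _ => by linarith⟩⟩
    · refine convexOn_iff_forall_pos.2 ⟨convex_univ, fun p₁ _ p₂ _ a₁ a₂ ha₁ ha₂ ha => ?_⟩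
      obtain ⟨v₁, hv₁⟩ := hG p₁
      obtain ⟨v₂, hv₂⟩ := hG p₂
      obtain ⟨v, hv⟩ := hG (a₁ • p₁ + a₂ • p₂)
      exact hv₁.convex_combination hΩ h1 h2 h3 h7 hv₂ ha₁ ha₂ ha hv
    · obtain ⟨C, hC⟩ := h1.exists_le R
      refine ⟨C, fun _ p hp => ?_⟩
      obtain ⟨v, hv⟩ := hG p
      obtain ⟨y, hy⟩ := hv.exists_le hΩ
      exact hy.trans (hC y p hp)
  · rw [effectiveHamiltonian, dif_neg h]
    exact admissibleHamiltonian_zero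

/-! ### Removing the boundary value and the obstacle -/

lemma bBar_le {b : Euc n → Euc n → ℝ} (h4 : A4 Ω b) (x : Euc n) {y : Euc n}
    (hy : y ∈ frontier Ω) : bBar Ω b x ≤ b x y := by
  obtain ⟨C, hC⟩ := h4.1
  refine csInf_le ⟨-C, ?_⟩ ⟨y, hy, rfl⟩
  rintro _ ⟨z, hz, rfl⟩
  exact (abs_le.1 (hC x z hz)).1

lemma inv_smul_mem_frontier {ε : ℝ} (hε : 0 < ε) {x : Euc n} (hx : x ∈ frontier (ε • Ω)) :
    ε⁻¹ • x ∈ frontier Ω := by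
  rw [frontier, closure_smul₀, interior_smul₀ hε.ne'] at hx
  exact ⟨(mem_smul_set_iff_inv_smul_mem₀ hε.ne' _ x).1 hx.1, fun h =>
    hx.2 ((mem_smul_set_iff_inv_smul_mem₀ hε.ne' _ x).2 h)⟩

/-- Only boundary points with `u ≥ b` are in question. There `u(x, s) ≤ g(x) ≤ b̄(x) ≤ b ≤ u(x, t)`
for all `s > 0`, so a test function from below has `φ_t ≥ 0`, and `H ≥ 0` finishes. -/
theorem IsDirichletSolution.isStateConstraintSolution {b : Euc n → Euc n → ℝ} {g : Euc n → ℝ}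
    {ε : ℝ} {u : Euc n × ℝ → ℝ} (hΩ : IsPerforatedDomain Ω) (h4 : A4 Ω b) (h5 : A5 Ω b g)
    (h7 : A7 H) (hε : 0 < ε) (hu : IsDirichletSolution H Ω b g ε u) :
    IsStateConstraintSolution H Ω g ε u := by
  refine ⟨hu.inClass, hu.sub_interior, fun z hz φ hφ hmin => ?_⟩
  have hcone := (hasInwardCone_of_hasC1Boundary hΩ.isOpen hΩ.c1Boundary).smul hε
  have hanti : ∀ {s t : ℝ}, 0 ≤ s → s ≤ t → u (z.1, t) ≤ u (z.1, s) := fun hs hst =>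
    antitone_of_viscSub (F := fun x p => H (ε⁻¹ • x) p) hcone (fun x p => (h7 _).2 p) hu.inClass
      hu.sub_interior hz.1 hs hst
  have hz2 : 0 < z.2 := hz.2
  by_cases hzΩ : z.1 ∈ ε • Ω
  · exact hu.super_interior z ⟨hzΩ, hz2⟩ φ hφ
      (hmin.filter_mono (nhdsWithin_mono _ (prod_mono subset_closure Subset.rfl)))
  · have hfr : z.1 ∈ frontier (ε • Ω) := ⟨hz.1, fun h => hzΩ (interior_subset h)⟩
    rcases le_max_iff.1 (hu.super_boundary z ⟨hfr, hz2⟩ φ hφ hmin) with h | h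
    · exact h
    · have hb := bBar_le h4 z.1 (inv_smul_mem_frontier hε hfr)
      have ht := deriv_time_nonneg hz hφ hmin fun s hs _ => by
        have h1 := hanti le_rfl hs.le
        rw [hu.inClass.init _ hz.1] at h1
        linarith [h5.2.2 z.1]
      exact add_nonneg ht ((h7 _).2 _)

/-- The subsolution half is immediate from the maximum. Where `u ≥ β`, the past values are at most
`g ≤ β ≤ u`, so again `φ_t ≥ 0`. -/
theorem IsObstacleSolution.isCauchySolution {G β g : Euc n → ℝ} {u : Euc n × ℝ → ℝ}
    (hG : ∀ p, 0 ≤ G p) (hgβ : ∀ x, g x ≤ β x) (hu : IsObstacleSolution G β g u) :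
    IsCauchySolution G g u := by
  have hsub : ViscSub (univ ×ˢ Ioi 0) (univ ×ˢ Ioi 0) (fun _ _ a p => a + G p) u :=
    fun z hz φ hφ hmax => (le_max_right _ _).trans (hu.sub z hz φ hφ hmax)
  refine ⟨hu.inClass, hsub, fun z hz φ hφ hmin => ?_⟩
  rcases le_max_iff.1 (hu.super z hz φ hφ hmin) with h | h
  · have ht := deriv_time_nonneg hz hφ hmin fun s hs _ => by
      have h1 := antitone_of_viscSub (F := fun _ => G) (x := z.1) hasInwardCone_univ
        (fun _ => hG) (by rw [closure_univ]; exact hu.inClass) hsub (by simp) le_rfl hs.le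
      rw [hu.inClass.init _ (mem_univ _)] at h1
      linarith [hgβ z.1]
    exact add_nonneg ht (hG _)
  · exact h

end CellProblem

end PerforatedHJ

/-! ### The theorem -/

open PerforatedHJ
theorem lemma5p3 {n : ℕ} (Ω : Set (Euc n)) (hΩ : IsPerforatedDomain Ω)
    (H : Euc n → Euc n → ℝ) (b : Euc n → Euc n → ℝ) (g : Euc n → ℝ)
    (h1 : A1 H) (h2 : A2 H) (h3 : A3 H) (h4 : A4 Ω b) (h5 : A5 Ω b g) (h7 : A7 H) :
    (∀ ε : ℝ, 0 < ε → ∀ u : Euc n × ℝ → ℝ, IsDirichletSolution H Ω b g ε u →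
      IsStateConstraintSolution H Ω g ε u ∧
      ∀ v : Euc n × ℝ → ℝ, IsStateConstraintSolution H Ω g ε v →
        EqOn u v (closure (ε • Ω) ×ˢ Ici 0)) ∧
    (∀ u : Euc n × ℝ → ℝ, IsObstacleSolution (effectiveHamiltonian H Ω) (bBar Ω b) g u →
      IsCauchySolution (effectiveHamiltonian H Ω) g u ∧
      ∀ v : Euc n × ℝ → ℝ, IsCauchySolution (effectiveHamiltonian H Ω) g v →
        EqOn u v (univ ×ˢ Ici 0)) := by
  constructor
  · intro ε hε u hu
    have hu' := hu.isStateConstraintSolution hΩ h4 h5 h7 hε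
    have hopen : IsOpen (ε • Ω) := hΩ.isOpen.smul₀ hε.ne'
    have hcone := (hasInwardCone_of_hasC1Boundary hΩ.isOpen hΩ.c1Boundary).smul hε
    have hF := admissibleHamiltonian_scaled h1 h2 h3 h7 hε
    refine ⟨hu', fun v hv z hz => le_antisymm ?_ ?_⟩
    · exact comparison hopen hcone hF h5.2.1 hu'.inClass hv.inClass hu'.sub hv.super hz.1 hz.2
    · exact comparison hopen hcone hF h5.2.1 hv.inClass hu'.inClass hv.sub hu'.super hz.1 hz.2
  · intro u hu
    have hu' := hu.isCauchySolution (effectiveHamiltonian_nonneg hΩ h7) h5.2.2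
    have hF := admissibleHamiltonian_effective hΩ h1 h2 h3 h7
    have hcomp : ∀ {u v : Euc n × ℝ → ℝ}, IsCauchySolution (effectiveHamiltonian H Ω) g u →
        IsCauchySolution (effectiveHamiltonian H Ω) g v → ∀ z ∈ univ ×ˢ Ici (0 : ℝ), u z ≤ v z := by
      intro u v hu hv z hz
      refine comparison isOpen_univ hasInwardCone_univ hF h5.2.1 (x := z.1) (t := z.2) ?_ ?_ hu.sub
        ?_ ?_ hz.2 <;> rw [closure_univ]
      exacts [hu.inClass, hv.inClass, hv.super, hz.1]
    exact ⟨hu', fun v hv z hz => le_antisymm (hcomp hu' hv z hz) (hcomp hv hu' z hz)⟩
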